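/- **Setting.** Let $S$ be a countable set, $p:S\times S\to[0,\infty)$ a symmetric random walk kernel ($p(i,l)=p(l,i)\ge 0$ and $\sum_{l\in S}p(i,l)=1$ for all $i$), $\partial S\subseteq S$ an arbitrary subset (the boundary), and $0<\rho_i<1$ for $i\in\partial S$ (the reservoir densities). Let $\partial_eS$ be a set of sink sites, disjoint from $S$, with a bijection $i\mapsto i_e$ from $\partial S$ to $\partial_eS$, and put $\rho_{i_e}:=\rho_i$. The *boundary driven exclusion process* $(\eta_t)_{t\ge0}$ is the Markov process on $\{0,1\}^S$ whose generator acts on local functions $f$ (functions of finitely many coordinates) by $$\mathcal L f(\eta)=\sum_{i,l\in S}p(i,l)\,\eta(i)(1-\eta(l))\,\bigl(f(\eta^{i,l})-f(\eta)\bigr)+\sum_{i\in\partial S}\Bigl[(1-\rho_i)\,\eta(i)+\rho_i\,(1-\eta(i))\Bigr]\bigl(f(\eta^i)-f(\eta)\bigr),$$ where $\eta^{i,l}$ is $\eta$ with a particle removed from $i$ and placed at $l$, and $\eta^i$ is $\eta$ with the occupancy at $i$ flipped. The *dual process* $(\xi_t)_{t\ge0}$ is the Markov process on the set $\Omega_{dual}$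 of all maps $\xi:S\cup\partial_eS\to\{0,1,2,\dots\}$ with $\xi(i)\in\{0,1\}$ for $i\in S$, whose generator acts on bounded functions $f$ of finitely many coordinates by $$\mathcal L_{dual} f(\xi)=\sum_{i,l\in S}p(i,l)\,\xi(i)(1-\xi(l))\,\bigl(f(\xi^{i,l})-f(\xi)\bigr)+\sum_{i\in\partial S}\xi(i)\,\bigl(f(\xi^{i,i_e})-f(\xi)\bigr),$$ where $\xi^{x,y}$ is $\xi$ with a particle removed from $x$ and placed at $y$. Here "the generator of a Markov process acts on $f$ by $\mathcal G f$" means that $t^{-1}\bigl(\mathbb E_x f(X_t)-f(x)\bigr)\to\mathcal G f(x)$ as $t\downarrow0$, uniformly in the starting point $x$. **Theorem.** The two processes are dual to each other with duality function $$D(\eta,\xi)=\Bigl(\prod_{i\in S:\,\xi(i)=1}\eta(i)\Bigr)\Bigl(\prod_{i\in\partial_eS}\rho_i^{\xi(i)}\Bigr)$$ (an infinite product of factors in $[0,1]$ being the limit of its finite partial products); that is, for all $t\ge0$, all $\eta\in\{0,1\}^S$ and all $\xi\in\Omega_{dual}$, $$\mathbb E_\eta D(\eta_t,\xi)=\mathbb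 E_\xi D(\eta,\xi_t).$$ -/

import Mathlib

open MeasureTheory ProbabilityTheory Filter Topology
open scoped NNReal

noncomputable section

namespace BoundaryExclusion

/-! ### Markov processes, generators, duality -/

/-- A time-homogeneous Markov process on `X`, given by its transition kernels
`P t x A = ℙ_x (X_t ∈ A)`: so `∫ y, f y ∂(P t x)` is the expectation `𝔼_x f(X_t)`. -/
structure IsMarkovProcess {X : Type*} [MeasurableSpace X] (P : ℝ≥0 → Kernel X X) : Prop where
  markov : ∀ t, IsMarkovKernel (P t)
  zero : P 0 = Kernel.id
  chapman_kolmogorov : ∀ s t, P (s + t) = P t ∘ₖ P s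

/-- The process with transition kernels `P` has generator `L` on the set `T` of test functions:
`(𝔼_x f(X_t) - f x) / t → L f x` as `t ↓ 0`, uniformly in `x`, for every `f ∈ T`. -/
def HasGeneratorOn {X : Type*} [MeasurableSpace X] (P : ℝ≥0 → Kernel X X)
    (T : Set (X → ℝ)) (L : (X → ℝ) → X → ℝ) : Prop :=
  ∀ f ∈ T, TendstoUniformly
    (fun (t : ℝ≥0) (x : X) => ((∫ y, f y ∂(P t x)) - f x) / (t : ℝ)) (L f) (𝓝[>] 0)

/-- Duality of two Markov processes with duality function `D`:
`𝔼_η D(η_t, ξ) = 𝔼^dual_ξ D(η, ξ_t)` for all `t`, `η`, `ξ`, both expectations being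
well defined. -/
def IsDual {X Y : Type*} [MeasurableSpace X] [MeasurableSpace Y]
    (P : ℝ≥0 → Kernel X X) (Q : ℝ≥0 → Kernel Y Y) (D : X → Y → ℝ) : Prop :=
  ∀ (t : ℝ≥0) (η : X) (ξ : Y),
    Integrable (fun η' => D η' ξ) (P t η) ∧ Integrable (fun ξ' => D η ξ') (Q t ξ) ∧
      ∫ η', D η' ξ ∂(P t η) = ∫ ξ', D η ξ' ∂(Q t ξ)

/-! ### Symmetric random walk kernels -/

/-- `p` is a symmetric random walk kernel: `p i l = p l i ≥ 0` and `∑_l p i l = 1`. -/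
structure IsSymmetricKernel {S : Type*} (p : S → S → ℝ) : Prop where
  nonneg : ∀ i l, 0 ≤ p i l
  symm : ∀ i l, p i l = p l i
  hasSum : ∀ i, HasSum (p i) 1

/-! ### The boundary driven exclusion process -/

/-- Configurations `η ∈ {0,1}^S`; `true` stands for `1` (a particle). -/
abbrev Config (S : Type*) := S → Bool

/-- The occupation number `0` or `1` as a real number. -/
def occ (b : Bool) : ℝ := if b then 1 else 0

/-- `η^{i,l}`: a particle is removed from `i` and placed at `l`. -/
def move {S : Type*} [DecidableEq S] (η : Config S) (i l : S) : Config S :=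
  Function.update (Function.update η i false) l true

/-- `η^i`: the occupancy at `i` is flipped. -/
def flipAt {S : Type*} [DecidableEq S] (η : Config S) (i : S) : Config S :=
  Function.update η i (!η i)

/-- Local functions on `{0,1}^S`: those that depend on finitely many coordinates. -/
def localFunctions (S : Type*) : Set (Config S → ℝ) :=
  {f | ∃ K : Finset S, ∀ η η' : Config S, (∀ i ∈ K, η i = η' i) → f η = f η'}

/-- The generator of symmetric exclusion on `S` with creation and annihilation of particles at
the sites of the boundary `B`, with reservoir densities `ρ`. -/
def gen {S : Type*} [DecidableEq S] (p : S → S → ℝ) (B : Set S) (ρ : B → ℝ)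
    (f : Config S → ℝ) (η : Config S) : ℝ :=
  (∑' x : S × S, p x.1 x.2 * (occ (η x.1) * (1 - occ (η x.2))) * (f (move η x.1 x.2) - f η)) +
    ∑' i : B, ((1 - ρ i) * occ (η i) * (f (flipAt η i) - f η) +
      ρ i * (1 - occ (η i)) * (f (flipAt η i) - f η))

/-! ### The dual process with absorbing sinks -/

/-- Dual configurations `ξ : S ∪ ∂ₑS → ℕ` with `ξ(i) ∈ {0,1}` for `i ∈ S`. There is one sink site
`i_e` for each boundary site `i ∈ B`; the first component of `ξ` is its restriction to `S`, and
`ξ.2 i` is the number of particles at the sink `i_e`. -/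
abbrev DualConfig (S : Type*) (B : Set S) := Config S × (B → ℕ)

/-- `ξ^{i,l}` for `i, l ∈ S`. -/
def dualMove {S : Type*} [DecidableEq S] {B : Set S} (ξ : DualConfig S B) (i l : S) :
    DualConfig S B :=
  (move ξ.1 i l, ξ.2)

/-- `ξ^{i,i_e}`: the particle at the boundary site `i` is moved to the sink `i_e`. -/
def absorb {S : Type*} [DecidableEq S] {B : Set S} (ξ : DualConfig S B) (i : B) :
    DualConfig S B :=
  (Function.update ξ.1 i false, Function.update ξ.2 i (ξ.2 i + 1))

/-- Bounded functions of the dual configuration that depend on finitely many coordinates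
(sites of `S` and sink sites). -/
def dualLocalFunctions (S : Type*) (B : Set S) : Set (DualConfig S B → ℝ) :=
  {f | (∃ (K : Finset S) (J : Finset B), ∀ ξ ξ' : DualConfig S B,
      (∀ i ∈ K, ξ.1 i = ξ'.1 i) → (∀ j ∈ J, ξ.2 j = ξ'.2 j) → f ξ = f ξ') ∧
    ∃ C : ℝ, ∀ ξ, |f ξ| ≤ C}

/-- The generator of the dual process: symmetric exclusion on `S`, and particles at boundary
sites move to the corresponding sink at rate `1`, where they stay. -/
def dualGen {S : Type*} [DecidableEq S] (p : S → S → ℝ) (B : Set S)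
    (f : DualConfig S B → ℝ) (ξ : DualConfig S B) : ℝ :=
  (∑' x : S × S, p x.1 x.2 * (occ (ξ.1 x.1) * (1 - occ (ξ.1 x.2))) *
      (f (dualMove ξ x.1 x.2) - f ξ)) +
    ∑' i : B, occ (ξ.1 i) * (f (absorb ξ i) - f ξ)

/-- The duality function `∏_{i ∈ S : ξ(i) = 1} η(i) · ∏_{sinks} ρ_i ^ ξ_i`. All factors lie in
`[0,1]` (when the densities do), so possibly infinite products are limits of the decreasing
finite ones. -/
def dualityFunction {S : Type*} {B : Set S} (ρ : B → ℝ) (η : Config S) (ξ : DualConfig S B) : ℝ :=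
  (∏' i : {i : S // ξ.1 i = true}, occ (η i)) * ∏' i : B, ρ i ^ ξ.2 i

end BoundaryExclusion

end

/-!
The duality function is the decreasing limit of the functions `cylDuality ρ K`, in which both
products are restricted to a finite set `K` of sites and its sinks. These are local in both
arguments, so the generators of both processes may be applied to them; no further information on
the two semigroups is available, and none is needed.

Write the exclusion part of the generators in stirring form (`tsum_exclusion_eq_stirring`): the
contents of `i` and `l` are exchanged at rate `p i l`. An exchange of sites, both inside or both
outside `K`, acts in the same way on either argument of `cylDuality ρ K`, and a reservoir acts on
the first argument as absorption acts on the second. Hence the generators are dual to each other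
up to exchanges across the boundary of `K` that involve a dual particle
(`abs_gen_sub_dualGen_le`). Interpolating between the two sides of the duality relation
(`abs_sub_le_of_approx_duality`), the defect is at most `t` times the expected rate of such
exchanges. If `ξ` has finitely many particles on `S`, the expected occupation numbers of the dual
process are bounded by a summable function, and the defect vanishes as `K` increases to `S`
(`integral_dualityFunction_eq_of_finite`).

For general `ξ`, let `truncate K ξ` be `ξ` without the particles on `S` outside `K`. The left side
of the duality relation is continuous along these truncations by dominated convergence. For the
right side one uses that `η ↦ cylDuality ρ L η ξ` depends on `η` through the finite set `ζ` of empty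
sites of `L`, and that the dual generator acts on the functions `hole ρ J ζ` so obtained as the
generator `holeGen` of a Markov chain of holes acts on functions of `ζ` (`dualGen_hole`). So the
expectations of `hole ρ J ζ` solve a backward equation, to which a minimum principle applies
(`nonneg_of_deriv_right`, `holeGen_comparison`). It yields that the expectations are monotone in
the initial state, which bounds the right side by its values at the truncations, and that they are
continuous along truncations, which gives the opposite inequality. The same comparison yields the
bound on the occupation numbers used above. The Lyapunov functions in it are sums over `ζ` of
potentials of the Green function `∑_k 2^{-k} p^k` of the random walk.
-/

noncomputable section

namespace BoundaryExclusion

/-! ### A minimum principle for families of functions -/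

lemma lower_bound_improve {u u' : ℝ → ℝ} {T Λ c : ℝ} (hΛ : 0 ≤ Λ) (hc : c ≤ 0)
    (hcont : ContinuousOn u (Set.Icc 0 T))
    (hderiv : ∀ s ∈ Set.Ico 0 T, HasDerivWithinAt u (u' s) (Set.Ici s) s)
    (h0 : 0 ≤ u 0) (hu' : ∀ s ∈ Set.Ico 0 T, Λ * (c - u s) ≤ u' s) :
    ∀ s ∈ Set.Icc 0 T, c * (1 - Real.exp (-(Λ * T))) ≤ u s := by
  intro s hs
  have hexp : ∀ r : ℝ, HasDerivAt (fun r => Real.exp (Λ * r)) (Real.exp (Λ * r) * Λ) r := by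
    intro r
    simpa using ((hasDerivAt_id r).const_mul Λ).exp
  have key : -(Real.exp (Λ * s) * (u s - c)) ≤ c := by
    refine image_le_of_deriv_right_le_deriv_boundary (a := 0) (b := T)
      (f := fun r => -(Real.exp (Λ * r) * (u r - c)))
      (f' := fun r => -(Real.exp (Λ * r) * Λ * (u r - c) + Real.exp (Λ * r) * u' r))
      (B := fun _ => c) (B' := fun _ => 0) ?_ ?_ ?_ ?_ ?_ ?_ hs
    · exact ((Continuous.continuousOn (by fun_prop)).mul (hcont.sub continuousOn_const)).neg
    · intro r hr
      exact ((hexp r).hasDerivWithinAt.mul ((hderiv r hr).sub_const c)).neg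
    · simpa using h0
    · exact continuousOn_const
    · intro r _
      exact hasDerivWithinAt_const r _ c
    · intro r hr
      have h1 := mul_le_mul_of_nonneg_left (hu' r hr) (Real.exp_pos (Λ * r)).le
      nlinarith [h1]
  have h2 : c * (1 - Real.exp (-(Λ * s))) ≤ u s := by
    have h3 := mul_le_mul_of_nonneg_left key (Real.exp_pos (-(Λ * s))).le
    have h4 : Real.exp (-(Λ * s)) * Real.exp (Λ * s) = 1 := by
      rw [← Real.exp_add]; simp
    have h5 : Real.exp (-(Λ * s)) * -(Real.exp (Λ * s) * (u s - c)) = -(u s - c) := by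
      calc _ = -((Real.exp (-(Λ * s)) * Real.exp (Λ * s)) * (u s - c)) := by ring
        _ = _ := by rw [h4, one_mul]
    rw [h5] at h3
    linarith
  have h6 : Real.exp (-(Λ * T)) ≤ Real.exp (-(Λ * s)) :=
    Real.exp_le_exp.2 (neg_le_neg (mul_le_mul_of_nonneg_left hs.2 hΛ))
  nlinarith

/-- Minimum principle: if a uniformly bounded family `u i` starts nonnegative and each member is
either known to be nonnegative or pushed back, with a strength at most `Λ`, towards any common
lower bound, then the whole family is nonnegative. Each lower bound `c` improves to `c q` for a
fixed `q < 1`, and this is iterated. -/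
lemma nonneg_of_deriv_right {ι : Type*} {u u' : ι → ℝ → ℝ} {T Λ M : ℝ} (hΛ : 0 ≤ Λ) (hM : 0 ≤ M)
    (hcont : ∀ i, ContinuousOn (u i) (Set.Icc 0 T))
    (hderiv : ∀ i, ∀ s ∈ Set.Ico 0 T, HasDerivWithinAt (u i) (u' i s) (Set.Ici s) s)
    (h0 : ∀ i, 0 ≤ u i 0) (hbound : ∀ i, ∀ s ∈ Set.Icc 0 T, -M ≤ u i s)
    (h : ∀ i, (∀ s ∈ Set.Icc 0 T, 0 ≤ u i s) ∨
      ∀ s ∈ Set.Ico 0 T, ∀ c ≤ 0, (∀ j, c ≤ u j s) → Λ * (c - u i s) ≤ u' i s) :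
    ∀ i, ∀ s ∈ Set.Icc 0 T, 0 ≤ u i s := by
  rcases lt_or_ge T 0 with hT | hT
  · intro i s hs
    exact absurd (hs.1.trans hs.2) (not_le.2 hT)
  set q := 1 - Real.exp (-(Λ * T)) with hq
  have hq0 : 0 ≤ q := by
    have : Real.exp (-(Λ * T)) ≤ 1 := Real.exp_le_one_iff.2 (by nlinarith)
    linarith
  have hq1 : q < 1 := by linarith [Real.exp_pos (-(Λ * T))]
  have key : ∀ n : ℕ, ∀ i, ∀ s ∈ Set.Icc 0 T, -M * q ^ n ≤ u i s := by
    intro n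
    induction n with
    | zero => simpa using hbound
    | succ n ih =>
      intro i s hs
      have hneg : -M * q ^ n ≤ 0 := by
        have := mul_nonneg hM (pow_nonneg hq0 n)
        linarith
      rcases h i with hi | hi
      · have := mul_nonneg hM (pow_nonneg hq0 (n + 1))
        linarith [hi s hs]
      · have := lower_bound_improve hΛ hneg (hcont i) (hderiv i) (h0 i)
          (fun r hr => hi r hr _ hneg fun j => ih j r ⟨hr.1, hr.2.le⟩) s hs
        calc _ = -M * q ^ n * q := by ring
          _ ≤ _ := this
  intro i s hs
  have hlim : Tendsto (fun n : ℕ => -M * q ^ n) atTop (𝓝 (-M * 0)) :=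
    (tendsto_pow_atTop_nhds_zero_of_lt_one hq0 hq1).const_mul _
  rw [mul_zero] at hlim
  exact le_of_tendsto' hlim fun n => key n i s hs

/-! ### Expectations under a Markov process -/

section Markov

variable {X Y : Type*} [MeasurableSpace X] [MeasurableSpace Y]

lemma integrable_of_bounded {μ : Measure X} [IsProbabilityMeasure μ] {f : X → ℝ}
    (hf : Measurable f) {C : ℝ} (hC : ∀ x, |f x| ≤ C) : Integrable f μ :=
  Integrable.of_bound hf.aestronglyMeasurable C (ae_of_all _ hC)

lemma abs_integral_le {μ : Measure X} [IsProbabilityMeasure μ] {f : X → ℝ} {C : ℝ}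
    (hC : ∀ x, |f x| ≤ C) : |∫ x, f x ∂μ| ≤ C := by
  have := norm_integral_le_of_norm_le_const (μ := μ) (f := f) (C := C) (ae_of_all _ hC)
  simpa using this

lemma IsMarkovProcess.integral_add {P : ℝ≥0 → Kernel X X} (hP : IsMarkovProcess P) (s t : ℝ≥0)
    (x : X) {f : X → ℝ} (hf : Measurable f) {C : ℝ} (hC : ∀ x, |f x| ≤ C) :
    ∫ y, f y ∂(P (s + t) x) = ∫ z, ∫ y, f y ∂(P t z) ∂(P s x) := by
  have := hP.markov
  rw [hP.chapman_kolmogorov]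
  exact Kernel.integral_comp (integrable_of_bounded hf hC)

lemma IsMarkovProcess.integral_zero {P : ℝ≥0 → Kernel X X} (hP : IsMarkovProcess P)
    (x : X) {f : X → ℝ} (hf : Measurable f) : ∫ y, f y ∂(P 0 x) = f x := by
  rw [hP.zero, Kernel.id_apply, integral_dirac' _ _ hf.stronglyMeasurable]

lemma measurable_integral_kernel {κ : Kernel X Y} [IsMarkovKernel κ] {f : Y → ℝ}
    (hf : Measurable f) : Measurable fun x => ∫ y, f y ∂(κ x) :=
  (StronglyMeasurable.integral_kernel hf.stronglyMeasurable).measurable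

lemma eventually_sub_le_of_generator {P : ℝ≥0 → Kernel X X} {f g : X → ℝ}
    (h : TendstoUniformly (fun (t : ℝ≥0) (x : X) => ((∫ y, f y ∂(P t x)) - f x) / (t : ℝ)) g
      (𝓝[>] 0)) {ε : ℝ} (hε : 0 < ε) :
    ∀ᶠ t : ℝ≥0 in 𝓝[>] 0, ∀ x, |(∫ y, f y ∂(P t x)) - f x - t * g x| ≤ t * ε := by
  filter_upwards [Metric.tendstoUniformly_iff.1 h ε hε, self_mem_nhdsWithin] with t ht ht0 x
  have ht0' : (0 : ℝ) < t := ht0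
  have h1 := (ht x).le
  rw [dist_comm, Real.dist_eq] at h1
  have h2 : (∫ y, f y ∂(P t x)) - f x - t * g x
      = t * (((∫ y, f y ∂(P t x)) - f x) / (t : ℝ) - g x) := by
    field_simp
  rw [h2, abs_mul, abs_of_pos ht0']
  exact mul_le_mul_of_nonneg_left h1 ht0'.le

lemma measurable_of_generator {P : ℝ≥0 → Kernel X X} (hP : IsMarkovProcess P) {f g : X → ℝ}
    (h : TendstoUniformly (fun (t : ℝ≥0) (x : X) => ((∫ y, f y ∂(P t x)) - f x) / (t : ℝ)) g
      (𝓝[>] 0)) (hf : Measurable f) : Measurable g := by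
  have := hP.markov
  exact measurable_of_tendsto_metrizable' (𝓝[>] (0 : ℝ≥0))
    (fun t => ((measurable_integral_kernel hf).sub hf).div_const _)
    (tendsto_pi_nhds.2 fun x => h.tendsto_at x)

lemma exists_abs_le_of_generator {P : ℝ≥0 → Kernel X X} (hP : IsMarkovProcess P) {f g : X → ℝ}
    (h : TendstoUniformly (fun (t : ℝ≥0) (x : X) => ((∫ y, f y ∂(P t x)) - f x) / (t : ℝ)) g
      (𝓝[>] 0)) {C : ℝ} (hC : ∀ x, |f x| ≤ C) : ∃ C', ∀ x, |g x| ≤ C' := by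
  have := hP.markov
  obtain ⟨t, ht, ht0⟩ := ((Metric.tendstoUniformly_iff.1 h 1 one_pos).and
    self_mem_nhdsWithin).exists
  have ht0' : (0 : ℝ) < t := ht0
  refine ⟨1 + (C + C) / t, fun x => ?_⟩
  have h1 := (ht x).le
  rw [Real.dist_eq] at h1
  have h2 : |((∫ y, f y ∂(P t x)) - f x) / (t : ℝ)| ≤ (C + C) / t := by
    rw [abs_div, abs_of_pos ht0']
    gcongr
    exact (abs_sub _ _).trans (add_le_add (abs_integral_le hC) (hC x))
  calc |g x| = |(g x - ((∫ y, f y ∂(P t x)) - f x) / (t : ℝ)) +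
          ((∫ y, f y ∂(P t x)) - f x) / (t : ℝ)| := by congr 1; ring
    _ ≤ _ := (abs_add_le _ _).trans (add_le_add h1 h2)

/-- Forward equation, before the limit: the increments of `t ↦ 𝔼_x f(X_t)` are those predicted by
the generator, up to an error that is uniform in the time at which the increment starts. -/
lemma eventually_increment_le {P : ℝ≥0 → Kernel X X} (hP : IsMarkovProcess P) {f g : X → ℝ}
    (h : TendstoUniformly (fun (t : ℝ≥0) (x : X) => ((∫ y, f y ∂(P t x)) - f x) / (t : ℝ)) g
      (𝓝[>] 0)) (hf : Measurable f) {C : ℝ} (hfC : ∀ x, |f x| ≤ C) {ε : ℝ} (hε : 0 < ε) :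
    ∀ᶠ t : ℝ≥0 in 𝓝[>] 0, ∀ s x,
      |(∫ y, f y ∂(P (s + t) x)) - (∫ y, f y ∂(P s x)) - t * ∫ y, g y ∂(P s x)| ≤ t * ε := by
  have := hP.markov
  filter_upwards [eventually_sub_le_of_generator h hε] with t ht s x
  have i1 : Integrable (fun z => ∫ y, f y ∂(P t z)) (P s x) :=
    integrable_of_bounded (measurable_integral_kernel hf) (C := C) fun z => abs_integral_le hfC
  have i2 := integrable_of_bounded (μ := P s x) hf hfC
  obtain ⟨C', hgC⟩ := exists_abs_le_of_generator hP h hfC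
  have i3 := integrable_of_bounded (μ := P s x) (measurable_of_generator hP h hf) hgC
  have e := integral_sub (i1.sub i2) (i3.const_mul (t : ℝ))
  simp only [Pi.sub_apply] at e
  rw [hP.integral_add s t x hf hfC, ← integral_sub i1 i2, ← integral_const_mul, ← e]
  exact abs_integral_le ht

lemma hasDerivWithinAt_integral {P : ℝ≥0 → Kernel X X} (hP : IsMarkovProcess P) {f g : X → ℝ}
    (h : TendstoUniformly (fun (t : ℝ≥0) (x : X) => ((∫ y, f y ∂(P t x)) - f x) / (t : ℝ)) g
      (𝓝[>] 0)) (hf : Measurable f) {C : ℝ} (hfC : ∀ x, |f x| ≤ C) (x : X) {s : ℝ} (hs : 0 ≤ s) :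
    HasDerivWithinAt (fun r : ℝ => ∫ y, f y ∂(P r.toNNReal x)) (∫ y, g y ∂(P s.toNNReal x))
      (Set.Ici s) s := by
  rw [hasDerivWithinAt_iff_tendsto, Metric.tendsto_nhds]
  intro ε hε
  have h1 := eventually_increment_le hP h hf hfC (half_pos hε)
  have h2 : Tendsto (fun r : ℝ => (r - s).toNNReal) (𝓝[>] s) (𝓝[>] 0) := by
    refine tendsto_nhdsWithin_iff.2 ⟨?_, ?_⟩
    · have : Continuous fun r : ℝ => (r - s).toNNReal := by fun_prop
      have h3 := this.tendsto s
      simp only [sub_self, Real.toNNReal_zero] at h3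
      exact h3.mono_left nhdsWithin_le_nhds
    · filter_upwards [self_mem_nhdsWithin] with r hr
      simpa using hr
  rw [← Set.Ioi_insert, nhdsWithin_insert, eventually_sup]
  refine ⟨by simpa using hε, ?_⟩
  filter_upwards [h2.eventually h1, self_mem_nhdsWithin] with r hr hrs
  have hrs' : 0 < r - s := sub_pos.2 hrs
  have h4 : s.toNNReal + (r - s).toNNReal = r.toNNReal := by
    rw [← Real.toNNReal_add hs hrs'.le]; congr 1; ring
  have h5 := hr s.toNNReal x
  rw [h4, Real.coe_toNNReal _ hrs'.le] at h5
  rw [dist_zero_right, norm_mul, norm_inv, norm_norm, norm_norm, Real.norm_eq_abs, Real.norm_eq_abs,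
    abs_of_pos hrs', smul_eq_mul]
  calc _ ≤ (r - s)⁻¹ * ((r - s) * (ε / 2)) := by gcongr
    _ = ε / 2 := by field_simp
    _ < ε := by linarith

lemma continuousOn_integral {P : ℝ≥0 → Kernel X X} (hP : IsMarkovProcess P) {f g : X → ℝ}
    (h : TendstoUniformly (fun (t : ℝ≥0) (x : X) => ((∫ y, f y ∂(P t x)) - f x) / (t : ℝ)) g
      (𝓝[>] 0)) (hf : Measurable f) {C : ℝ} (hfC : ∀ x, |f x| ≤ C) (x : X) (A : Set ℝ) :
    ContinuousOn (fun r : ℝ => ∫ y, f y ∂(P r.toNNReal x)) A := by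
  have := hP.markov
  refine Continuous.continuousOn (Continuous.comp (g := fun t : ℝ≥0 => ∫ y, f y ∂(P t x)) ?_
    continuous_real_toNNReal)
  have hev := eventually_increment_le hP h hf hfC one_pos
  rw [eventually_nhdsWithin_iff, Metric.eventually_nhds_iff] at hev
  obtain ⟨δ, hδ, hev⟩ := hev
  obtain ⟨C', hgC⟩ := exists_abs_le_of_generator hP h hfC
  have hC : 0 ≤ C' := (abs_nonneg _).trans (hgC x)
  have key : ∀ s t : ℝ≥0, s ≤ t → dist t s < δ →
      |(∫ y, f y ∂(P t x)) - ∫ y, f y ∂(P s x)| ≤ dist t s * (C' + 1) := by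
    intro s t hst hd
    rcases hst.eq_or_lt with rfl | hlt
    · simp
    have hd' : dist t s = ((t - s : ℝ≥0) : ℝ) := by
      rw [NNReal.dist_eq, NNReal.coe_sub hst, abs_of_nonneg]
      exact sub_nonneg.2 hst
    have h1 := hev (y := t - s) (by rw [NNReal.dist_eq]; simpa [hd'] using hd)
      (tsub_pos_of_lt hlt) s x
    rw [add_tsub_cancel_of_le hst] at h1
    have h2 : |((t - s : ℝ≥0) : ℝ) * ∫ y, g y ∂(P s x)| ≤ ((t - s : ℝ≥0) : ℝ) * C' := by
      rw [abs_mul, abs_of_nonneg (NNReal.coe_nonneg _)]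
      exact mul_le_mul_of_nonneg_left (abs_integral_le hgC) (NNReal.coe_nonneg _)
    rw [hd']
    calc _ = |((∫ y, f y ∂(P t x)) - (∫ y, f y ∂(P s x)) -
            ((t - s : ℝ≥0) : ℝ) * ∫ y, g y ∂(P s x)) +
            ((t - s : ℝ≥0) : ℝ) * ∫ y, g y ∂(P s x)| := by congr 1; ring
      _ ≤ ((t - s : ℝ≥0) : ℝ) * 1 + ((t - s : ℝ≥0) : ℝ) * C' := (abs_add_le _ _).trans
          (add_le_add h1 h2)
      _ = _ := by ring
  rw [Metric.continuous_iff]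
  intro s ε hε
  refine ⟨min δ (ε / (C' + 1)), lt_min hδ (by positivity), fun t ht => ?_⟩
  have ht1 : dist t s < δ := ht.trans_le (min_le_left _ _)
  have ht2 : dist t s * (C' + 1) < ε := by
    rw [← lt_div_iff₀ (by positivity)]
    exact ht.trans_le (min_le_right _ _)
  rw [Real.dist_eq]
  rcases le_total s t with hst | hst
  · exact (key s t hst ht1).trans_lt ht2
  · rw [abs_sub_comm]
    rw [dist_comm] at ht1 ht2
    exact (key t s hst ht1).trans_lt ht2

/-- One step of the interpolation between the two sides of the duality relation. -/
lemma interpolation_step {P : ℝ≥0 → Kernel X X} (hP : IsMarkovProcess P) {Q : ℝ≥0 → Kernel Y Y}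
    (hQ : IsMarkovProcess Q) {D : X → Y → ℝ} (hD : Measurable (Function.uncurry D))
    (hD1 : ∀ x y, |D x y| ≤ 1) {E : Y → ℝ} {h : ℝ≥0} {ε : ℝ}
    (hE : ∀ x y, |(∫ x', D x' y ∂(P h x)) - ∫ y', D x y' ∂(Q h y)| ≤ h * (E y + ε))
    (r s : ℝ≥0) (x : X) (y : Y) (hEint : Integrable E (Q s y)) :
    |(∫ y', ∫ x', D x' y' ∂(P (r + h) x) ∂(Q s y)) -
        ∫ y', ∫ x', D x' y' ∂(P r x) ∂(Q (s + h) y)| ≤ h * ((∫ y', E y' ∂(Q s y)) + ε) := by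
  have := hP.markov
  have := hQ.markov
  have hDx : ∀ x, Measurable (D x) := fun x => hD.of_uncurry_left
  have hDy : ∀ y, Measurable fun x => D x y := fun y => hD.of_uncurry_right
  -- joint measurability of the two one-step expectations
  have mP : Measurable fun z : X × Y => ∫ x', D x' z.2 ∂(P h z.1) := by
    have := StronglyMeasurable.integral_kernel_prod_right'
      (κ := (P h).comap Prod.fst measurable_fst)
      (f := fun w : (X × Y) × X => D w.2 w.1.2)
      (hD.comp (measurable_snd.prodMk measurable_fst.snd)).stronglyMeasurable
    exact this.measurable
  have mQ : Measurable fun z : X × Y => ∫ y', D z.1 y' ∂(Q h z.2) := by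
    have := StronglyMeasurable.integral_kernel_prod_right'
      (κ := (Q h).comap Prod.snd measurable_snd)
      (f := fun w : (X × Y) × Y => D w.1.1 w.2)
      (hD.comp (measurable_fst.fst.prodMk measurable_snd)).stronglyMeasurable
    exact this.measurable
  have iP : Integrable (fun z : X × Y => ∫ x', D x' z.2 ∂(P h z.1)) ((P r x).prod (Q s y)) :=
    integrable_of_bounded mP (C := 1) fun z => abs_integral_le fun x' => hD1 _ _
  have iQ : Integrable (fun z : X × Y => ∫ y', D z.1 y' ∂(Q h z.2)) ((P r x).prod (Q s y)) :=
    integrable_of_bounded mQ (C := 1) fun z => abs_integral_le fun y' => hD1 _ _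
  have e1 : ∫ y', ∫ x', D x' y' ∂(P (r + h) x) ∂(Q s y)
      = ∫ z, ∫ x', D x' z.2 ∂(P h z.1) ∂((P r x).prod (Q s y)) := by
    rw [integral_prod_symm _ iP]
    refine integral_congr_ae (ae_of_all _ fun y' => ?_)
    exact hP.integral_add r h x (hDy y') fun x' => hD1 _ _
  have e2 : ∫ y', ∫ x', D x' y' ∂(P r x) ∂(Q (s + h) y)
      = ∫ z, ∫ y', D z.1 y' ∂(Q h z.2) ∂((P r x).prod (Q s y)) := by
    rw [integral_prod _ iQ, ← integral_integral_swap]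
    · refine integral_congr_ae (ae_of_all _ fun x' => ?_)
      exact hQ.integral_add s h y (hDx x') fun y' => hD1 _ _
    · exact integrable_of_bounded hD (C := 1) fun z => hD1 _ _
  rw [e1, e2, ← integral_sub iP iQ]
  have iE : Integrable (fun z : X × Y => h * (E z.2 + ε)) ((P r x).prod (Q s y)) :=
    ((hEint.comp_snd _).add (integrable_const _)).const_mul _
  calc _ ≤ ∫ z, |(∫ x', D x' z.2 ∂(P h z.1)) - ∫ y', D z.1 y' ∂(Q h z.2)|
          ∂((P r x).prod (Q s y)) := abs_integral_le_integral_abs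
    _ ≤ ∫ z, h * (E z.2 + ε) ∂((P r x).prod (Q s y)) :=
        integral_mono (iP.sub iQ).abs iE fun z => hE z.1 z.2
    _ = _ := by
        rw [integral_const_mul, integral_add (hEint.comp_snd _) (integrable_const _),
          integral_fun_snd]
        simp

/-- Interpolation `s ↦ 𝔼_{x,y} D(X_{t-s}, Y_s)` between the two sides of the duality relation: if
the two one-step expectations of `D` differ to first order by at most `E`, then the two sides
differ by at most `t` times a bound on the expectation of `E`. -/
lemma abs_sub_le_of_approx_duality {P : ℝ≥0 → Kernel X X} (hP : IsMarkovProcess P)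
    {Q : ℝ≥0 → Kernel Y Y} (hQ : IsMarkovProcess Q) {D : X → Y → ℝ}
    (hD : Measurable (Function.uncurry D)) (hD1 : ∀ x y, |D x y| ≤ 1) {E : Y → ℝ}
    (hE : ∀ ε > 0, ∀ᶠ h : ℝ≥0 in 𝓝[>] 0, ∀ x y,
      |(∫ x', D x' y ∂(P h x)) - ∫ y', D x y' ∂(Q h y)| ≤ h * (E y + ε))
    {t : ℝ≥0} {y : Y} {δ : ℝ} (hEint : ∀ s ≤ t, Integrable E (Q s y))
    (hEδ : ∀ s ≤ t, ∫ y', E y' ∂(Q s y) ≤ δ) (x : X) :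
    |(∫ x', D x' y ∂(P t x)) - ∫ y', D x y' ∂(Q t y)| ≤ t * δ := by
  have := hP.markov
  have := hQ.markov
  have hDx : ∀ x, Measurable (D x) := fun x => hD.of_uncurry_left
  have hDy : ∀ y, Measurable fun x => D x y := fun y => hD.of_uncurry_right
  have hDP : ∀ s : ℝ≥0, Measurable fun y' => ∫ x', D x' y' ∂(P s x) := fun s =>
    (hD.stronglyMeasurable.integral_prod_left).measurable
  rcases eq_or_ne t 0 with rfl | ht
  · simp [hP.integral_zero _ (hDy y), hQ.integral_zero _ (hDx x)]
  have key : ∀ ε > 0, |(∫ x', D x' y ∂(P t x)) - ∫ y', D x y' ∂(Q t y)| ≤ t * (δ + ε) := by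
    intro ε hε
    have hlim : Tendsto (fun n : ℕ => t / ((n : ℝ≥0) + 1)) atTop (𝓝[>] 0) := by
      refine tendsto_nhdsWithin_iff.2 ⟨?_, Eventually.of_forall fun n => ?_⟩
      · have h1 : Tendsto (fun n : ℕ => ((n : ℝ) + 1)) atTop atTop :=
          tendsto_atTop_add_const_right _ _ tendsto_natCast_atTop_atTop
        rw [← NNReal.tendsto_coe]
        push_cast
        exact tendsto_const_nhds.div_atTop h1
      · exact div_pos (pos_iff_ne_zero.2 ht) (by positivity)
    obtain ⟨n, h, hnh, hn⟩ : ∃ (n : ℕ) (h : ℝ≥0), ((n + 1 : ℕ) : ℝ≥0) * h = t ∧ ∀ x y,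
        |(∫ x', D x' y ∂(P h x)) - ∫ y', D x y' ∂(Q h y)| ≤ h * (E y + ε) := by
      obtain ⟨n, hn⟩ := (hlim.eventually (hE ε hε)).exists
      refine ⟨n, _, ?_, hn⟩
      push_cast
      exact mul_div_cancel₀ _ (by positivity)
    let F : ℕ → ℝ := fun k =>
      ∫ y', ∫ x', D x' y' ∂(P (((n + 1 - k : ℕ) : ℝ≥0) * h) x) ∂(Q ((k : ℝ≥0) * h) y)
    have hstep : ∀ k < n + 1, |F (k + 1) - F k| ≤ h * (δ + ε) := by
      intro k hk
      have e1 : ((n + 1 - k : ℕ) : ℝ≥0) * h = ((n + 1 - (k + 1) : ℕ) : ℝ≥0) * h + h := by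
        have : n + 1 - k = n + 1 - (k + 1) + 1 := by omega
        rw [this]; push_cast; ring
      have e2 : ((k + 1 : ℕ) : ℝ≥0) * h = (k : ℝ≥0) * h + h := by push_cast; ring
      have hkt : (k : ℝ≥0) * h ≤ t := by
        rw [← hnh]; gcongr
      have := interpolation_step hP hQ hD hD1 hn (((n + 1 - (k + 1) : ℕ) : ℝ≥0) * h)
        ((k : ℝ≥0) * h) x y (hEint _ hkt)
      rw [abs_sub_comm]
      simp only [F]
      rw [e1, e2]
      refine this.trans (mul_le_mul_of_nonneg_left ?_ (NNReal.coe_nonneg _))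
      linarith [hEδ _ hkt]
    have hsum : ∀ k ≤ n + 1, |F k - F 0| ≤ k * (h * (δ + ε)) := by
      intro k
      induction k with
      | zero => simp
      | succ k ih =>
        intro hk
        have := abs_sub_le (F (k + 1)) (F k) (F 0)
        have h1 := hstep k (by omega)
        have h2 := ih (by omega)
        push_cast
        linarith
    have hlast := hsum (n + 1) le_rfl
    have hF0 : F 0 = ∫ x', D x' y ∂(P t x) := by
      simp only [F, Nat.sub_zero, hnh, Nat.cast_zero, zero_mul]
      exact hQ.integral_zero _ (hDP t)
    have hFn : F (n + 1) = ∫ y', D x y' ∂(Q t y) := by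
      simp only [F, Nat.sub_self, hnh, Nat.cast_zero, zero_mul]
      refine integral_congr_ae (ae_of_all _ fun y' => ?_)
      exact hP.integral_zero _ (hDy y')
    rw [hF0, hFn, abs_sub_comm] at hlast
    calc _ ≤ _ := hlast
      _ = (((n + 1 : ℕ) : ℝ≥0) * h : ℝ≥0) * (δ + ε) := by push_cast; ring
      _ = _ := by rw [hnh]
  have ht0 : (0 : ℝ) < t := NNReal.coe_pos.2 (pos_iff_ne_zero.2 ht)
  refine le_of_forall_pos_le_add fun ε hε => ?_
  have := key (ε / t) (by positivity)
  calc _ ≤ _ := this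
    _ = _ := by field_simp

lemma integral_tsum_mul {ι : Type*} [Countable ι] {μ : Measure X} [IsProbabilityMeasure μ]
    {c : ι → ℝ} (hc : Summable c) (hc0 : ∀ i, 0 ≤ c i) {g : ι → X → ℝ} (hg : ∀ i, Measurable (g i))
    {C : ℝ} (hC : ∀ i x, |g i x| ≤ C) :
    ∫ x, (∑' i, c i * g i x) ∂μ = ∑' i, c i * ∫ x, g i x ∂μ := by
  have hint : ∀ i, Integrable (fun x => c i * g i x) μ := fun i =>
    (integrable_of_bounded (hg i) (hC i)).const_mul _
  rw [← integral_tsum_of_summable_integral_norm hint]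
  · simp only [integral_const_mul]
  · refine Summable.of_nonneg_of_le (fun i => integral_nonneg fun x => norm_nonneg _) (fun i => ?_)
      (hc.mul_right C)
    have : ∀ x, ‖c i * g i x‖ ≤ c i * C := fun x => by
      rw [norm_mul, Real.norm_of_nonneg (hc0 i)]
      exact mul_le_mul_of_nonneg_left (hC i x) (hc0 i)
    calc _ ≤ ∫ _, c i * C ∂μ := integral_mono (hint i).norm (integrable_const _) this
      _ = _ := by simp

lemma integrable_tsum_mul {ι : Type*} [Countable ι] {μ : Measure X} [IsProbabilityMeasure μ]
    {c : ι → ℝ} (hc : Summable c) (hc0 : ∀ i, 0 ≤ c i) {g : ι → X → ℝ} (hg : ∀ i, Measurable (g i))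
    {C : ℝ} (hC : ∀ i x, |g i x| ≤ C) : Integrable (fun x => ∑' i, c i * g i x) μ := by
  refine integrable_of_bounded (C := ∑' i, c i * C)
    (Measurable.tsum fun i => (hg i).const_mul (c i)) fun x => ?_
  rw [← Real.norm_eq_abs]
  refine tsum_of_norm_bounded (hc.mul_right C).hasSum fun i => ?_
  rw [norm_mul, Real.norm_of_nonneg (hc0 i)]
  exact mul_le_mul_of_nonneg_left (hC i x) (hc0 i)

end Markov

/-! ### Excessive functions of the random walk -/

section Green

open scoped ENNReal

variable {S : Type*} {p : S → S → ℝ}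

lemma tsum_ofReal_row (hp : IsSymmetricKernel p) (i : S) :
    ∑' l, ENNReal.ofReal (p i l) = 1 := by
  rw [← ENNReal.ofReal_tsum_of_nonneg (hp.nonneg i) (hp.hasSum i).summable, (hp.hasSum i).tsum_eq,
    ENNReal.ofReal_one]

lemma summable_mul_of_bounded (hp : IsSymmetricKernel p) {β : S → ℝ} (hβ0 : ∀ i, 0 ≤ β i) {C : ℝ}
    (hβC : ∀ i, β i ≤ C) (i : S) : Summable fun l => p i l * β l :=
  Summable.of_nonneg_of_le (fun l => mul_nonneg (hp.nonneg i l) (hβ0 l))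
    (fun l => mul_le_mul_of_nonneg_left (hβC l) (hp.nonneg i l))
    ((hp.hasSum i).summable.mul_right C)

variable [DecidableEq S]

/-- The `k`-step transition probabilities of the random walk, as extended nonnegative reals. -/
def walkPow (p : S → S → ℝ) : ℕ → S → S → ℝ≥0∞
  | 0 => fun i j => if i = j then 1 else 0
  | k + 1 => fun i j => ∑' l, ENNReal.ofReal (p i l) * walkPow p k l j

/-- The Green function `∑_k 2^{-k} p^k(i, j)` of the random walk killed with probability `1/2` at
each step. -/
def green (p : S → S → ℝ) (i j : S) : ℝ≥0∞ := ∑' k : ℕ, 2⁻¹ ^ k * walkPow p k i j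

/-- The potential `∑_{j ∈ A} green p i j` of a set `A`, a function of `i`. -/
def potential (p : S → S → ℝ) (A : Set S) (i : S) : ℝ := (∑' j, A.indicator (green p i) j).toReal

lemma tsum_walkPow_row (hp : IsSymmetricKernel p) (k : ℕ) (i : S) :
    ∑' j, walkPow p k i j = 1 := by
  induction k generalizing i with
  | zero => simp [walkPow]
  | succ k ih =>
    simp only [walkPow]
    rw [ENNReal.tsum_comm]
    simp [ENNReal.tsum_mul_left, ih, tsum_ofReal_row hp]

lemma tsum_walkPow_col (hp : IsSymmetricKernel p) (k : ℕ) (j : S) :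
    ∑' i, walkPow p k i j = 1 := by
  induction k with
  | zero => simp [walkPow]
  | succ k ih =>
    simp only [walkPow]
    rw [ENNReal.tsum_comm]
    simp_rw [ENNReal.tsum_mul_right, fun i l => hp.symm i l, tsum_ofReal_row hp, one_mul]
    exact ih

lemma tsum_green_row (hp : IsSymmetricKernel p) (i : S) : ∑' j, green p i j = 2 := by
  simp only [green]
  rw [ENNReal.tsum_comm]
  simp_rw [ENNReal.tsum_mul_left, tsum_walkPow_row hp, mul_one]
  rw [ENNReal.tsum_geometric, ENNReal.one_sub_inv_two, inv_inv]

lemma tsum_green_col (hp : IsSymmetricKernel p) (j : S) : ∑' i, green p i j = 2 := by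
  simp only [green]
  rw [ENNReal.tsum_comm]
  simp_rw [ENNReal.tsum_mul_left, tsum_walkPow_col hp, mul_one]
  rw [ENNReal.tsum_geometric, ENNReal.one_sub_inv_two, inv_inv]

lemma one_le_green_self (i : S) : 1 ≤ green p i i := by
  refine le_trans ?_ (ENNReal.le_tsum (f := fun k : ℕ => 2⁻¹ ^ k * walkPow p k i i) 0)
  simp [walkPow]

lemma tsum_mul_green_le (i j : S) :
    ∑' l, ENNReal.ofReal (p i l) * green p l j ≤ 2 * green p i j := by
  simp only [green]
  simp_rw [← ENNReal.tsum_mul_left]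
  rw [ENNReal.tsum_comm]
  have h : ∀ k : ℕ, ∑' l, ENNReal.ofReal (p i l) * (2⁻¹ ^ k * walkPow p k l j)
      = 2 * (2⁻¹ ^ (k + 1) * walkPow p (k + 1) i j) := by
    intro k
    simp only [walkPow]
    rw [pow_succ, ← mul_assoc, mul_comm (2⁻¹ ^ k) (2⁻¹ : ℝ≥0∞), ← mul_assoc,
      ENNReal.mul_inv_cancel (by simp) (by simp), one_mul, ← ENNReal.tsum_mul_left]
    exact tsum_congr fun l => by ring
  simp_rw [h]
  exact ENNReal.tsum_comp_le_tsum_of_injective (f := fun k : ℕ => k + 1) (add_left_injective 1)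
    fun k => 2 * (2⁻¹ ^ k * walkPow p k i j)

lemma tsum_indicator_green_le (hp : IsSymmetricKernel p) (A : Set S) (i : S) :
    ∑' j, A.indicator (green p i) j ≤ 2 := by
  rw [← tsum_green_row hp i]
  exact ENNReal.tsum_le_tsum fun j => Set.indicator_le_self _ _ j

lemma tsum_indicator_green_ne_top (hp : IsSymmetricKernel p) (A : Set S) (i : S) :
    ∑' j, A.indicator (green p i) j ≠ ∞ :=
  ((tsum_indicator_green_le hp A i).trans_lt (by simp)).ne

lemma potential_nonneg (A : Set S) (i : S) : 0 ≤ potential p A i := ENNReal.toReal_nonneg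

lemma potential_le_two (hp : IsSymmetricKernel p) (A : Set S) (i : S) : potential p A i ≤ 2 := by
  simpa [potential] using ENNReal.toReal_mono (by simp) (tsum_indicator_green_le hp A i)

lemma one_le_potential (hp : IsSymmetricKernel p) {A : Set S} {i : S} (hi : i ∈ A) :
    1 ≤ potential p A i := by
  have h : (1 : ℝ≥0∞) ≤ ∑' j, A.indicator (green p i) j := by
    refine le_trans ?_ (ENNReal.le_tsum i)
    rw [Set.indicator_of_mem hi]
    exact one_le_green_self i
  simpa [potential] using ENNReal.toReal_mono (tsum_indicator_green_ne_top hp A i) h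

lemma tsum_mul_potential_le (hp : IsSymmetricKernel p) (A : Set S) (i : S) :
    ∑' l, p i l * potential p A l ≤ 2 * potential p A i := by
  have h1 : ∑' l, ENNReal.ofReal (p i l) * ∑' j, A.indicator (green p l) j
      ≤ 2 * ∑' j, A.indicator (green p i) j := by
    simp_rw [← ENNReal.tsum_mul_left]
    rw [ENNReal.tsum_comm]
    refine ENNReal.tsum_le_tsum fun j => ?_
    by_cases hj : j ∈ A
    · simpa [hj] using tsum_mul_green_le i j
    · simp [hj]
  have h2 : ∑' l, p i l * potential p A l
      = (∑' l, ENNReal.ofReal (p i l) * ∑' j, A.indicator (green p l) j).toReal := by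
    rw [ENNReal.tsum_toReal_eq]
    · exact tsum_congr fun l => by
        rw [ENNReal.toReal_mul, ENNReal.toReal_ofReal (hp.nonneg i l), potential]
    · exact fun l => ENNReal.mul_ne_top ENNReal.ofReal_ne_top (tsum_indicator_green_ne_top hp A l)
  rw [h2]
  have h3 := ENNReal.toReal_mono
    (ENNReal.mul_ne_top (by simp) (tsum_indicator_green_ne_top hp A i)) h1
  simpa [ENNReal.toReal_mul, potential] using h3

lemma summable_potential (hp : IsSymmetricKernel p) (A : Finset S) :
    Summable (potential p (A : Set S)) := by
  refine ENNReal.summable_toReal ?_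
  rw [ENNReal.tsum_comm]
  have : ∀ j, ∑' i, (A : Set S).indicator (green p i) j = (A : Set S).indicator (fun _ => 2) j := by
    intro j
    by_cases hj : j ∈ (A : Set S)
    · simp only [Set.indicator_of_mem hj, tsum_green_col hp]
    · simp [hj]
  simp_rw [this]
  rw [← tsum_subtype, tsum_fintype]
  simp [ENNReal.mul_eq_top]

lemma tendsto_potential_compl (hp : IsSymmetricKernel p) (i : S) :
    Tendsto (fun K : Finset S => potential p ((K : Set S)ᶜ) i) atTop (𝓝 0) := by
  have h : ∑' j, green p i j ≠ ∞ := by rw [tsum_green_row hp]; simp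
  have h1 := (ENNReal.tendsto_toReal ENNReal.zero_ne_top).comp
    (ENNReal.tendsto_tsum_compl_atTop_zero h)
  refine h1.congr fun K => ?_
  simp only [Function.comp, potential]
  congr 1
  exact tsum_subtype ((K : Set S)ᶜ) (green p i)

end Green

/-! ### The generator of the process of holes -/

section Hole

variable {S : Type*} {p : S → S → ℝ} {B : Set S} {ρ : B → ℝ} {J : Finset B}

/-- The Lyapunov function `∑_{i ∈ ζ} β i + ∑_{j ∈ J} β j`; the second sum accounts for the holes
that are created at the boundary. -/
def weight (β : S → ℝ) (J : Finset B) (ζ : Finset S) : ℝ := ∑ i ∈ ζ, β i + ∑ j ∈ J, β j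

lemma weight_nonneg {β : S → ℝ} (hβ0 : ∀ i, 0 ≤ β i) (ζ : Finset S) : 0 ≤ weight β J ζ :=
  add_nonneg (Finset.sum_nonneg fun i _ => hβ0 i) (Finset.sum_nonneg fun j _ => hβ0 j)

lemma abs_weight_le {β : S → ℝ} (hβ0 : ∀ i, 0 ≤ β i) {C : ℝ} (hβC : ∀ i, β i ≤ C)
    (ζ : Finset S) : |weight β J ζ| ≤ (ζ.card + J.card) * C := by
  rw [abs_of_nonneg (weight_nonneg hβ0 ζ), weight, add_mul]
  refine add_le_add ?_ ?_
  · simpa using Finset.sum_le_card_nsmul ζ β C fun i _ => hβC i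
  · simpa using Finset.sum_le_card_nsmul J (fun j => β j) C fun i _ => hβC i

lemma le_weight {β : S → ℝ} (hβ0 : ∀ i, 0 ≤ β i) {δ : ℝ} (hδ : ∀ i, δ ≤ β i) (ζ : Finset S) :
    ζ.card * δ ≤ weight β J ζ := by
  have h1 := Finset.card_nsmul_le_sum ζ β δ fun i _ => hδ i
  rw [nsmul_eq_mul] at h1
  have h2 : 0 ≤ ∑ j ∈ J, β j := Finset.sum_nonneg fun j _ => hβ0 j
  unfold weight
  linarith

variable [DecidableEq S]

/-- The probability that boundary activity at `i` removes a hole rather than creates one, when the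
sinks outside `J` are disregarded: the reservoirs outside `J` then have density `1`. -/
def fillRate (ρ : B → ℝ) (J : Finset B) (i : B) : ℝ := if i ∈ J then ρ i else 1

open Classical in
/-- The generator of a Markov chain on finite sets `ζ` of holes: exclusion, written in stirring
form (every pair of sites exchanges its contents), together with filling and creation of holes at
the boundary. The boundary sites outside `J` and `ζ` have no effect, so the sum over the boundary
is finite. -/
def holeGen (p : S → S → ℝ) (ρ : B → ℝ) (J : Finset B) (y : Finset S → ℝ) (ζ : Finset S) : ℝ :=
  (∑' x : S × S, p x.1 x.2 / 2 * (y (ζ.map (Equiv.swap x.1 x.2).toEmbedding) - y ζ)) +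
    ∑ i ∈ J ∪ ζ.subtype (· ∈ B), (fillRate ρ J i * (y (ζ.erase i) - y ζ) +
      (1 - fillRate ρ J i) * (y (insert (i : S) ζ) - y ζ))

lemma fillRate_nonneg (hρ : ∀ i, 0 < ρ i ∧ ρ i < 1) (i : B) : 0 ≤ fillRate ρ J i := by
  unfold fillRate; split_ifs
  · exact (hρ i).1.le
  · exact zero_le_one

lemma fillRate_le_one (hρ : ∀ i, 0 < ρ i ∧ ρ i < 1) (i : B) : fillRate ρ J i ≤ 1 := by
  unfold fillRate; split_ifs
  · exact (hρ i).2.le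
  · exact le_rfl

lemma hasSum_mul_left {β : S → ℝ} (hβ : ∀ i, Summable fun l => p i l * β l) (ζ : Finset S) :
    HasSum (fun x : S × S => if x.1 ∈ ζ then p x.1 x.2 * β x.2 else 0)
      (∑ i ∈ ζ, ∑' l, p i l * β l) := by
  have h1 : ∀ i ∈ ζ, HasSum (fun x : S × S => if x.1 = i then p x.1 x.2 * β x.2 else 0)
      (∑' l, p i l * β l) := by
    intro i _
    have hinj : Function.Injective fun l : S => (i, l) := fun a b h => (Prod.mk.inj h).2
    rw [← hinj.hasSum_iff]
    · simpa [Function.comp_def] using (hβ i).hasSum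
    · rintro ⟨a, b⟩ hab
      have : a ≠ i := fun h => hab ⟨b, by simp [h]⟩
      simp [this]
  refine (hasSum_sum h1).congr_fun fun x => ?_
  simp

lemma hasSum_mul_right (hp : IsSymmetricKernel p) {β : S → ℝ}
    (hβ : ∀ i, Summable fun l => p i l * β l) (ζ : Finset S) :
    HasSum (fun x : S × S => if x.2 ∈ ζ then p x.1 x.2 * β x.1 else 0)
      (∑ i ∈ ζ, ∑' l, p i l * β l) := by
  have h := (Equiv.prodComm S S).hasSum_iff.2 (hasSum_mul_left hβ ζ)
  simpa [Function.comp_def, hp.symm] using h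

lemma summable_of_touch (hp : IsSymmetricKernel p) {K : Finset S} {F : S × S → ℝ} {C : ℝ}
    (hF : ∀ x, |F x| ≤ C * p x.1 x.2) (hF0 : ∀ x : S × S, x.1 ∉ K → x.2 ∉ K → F x = 0) :
    Summable F := by
  have hs : ∀ i, Summable fun l => p i l * (fun _ => (1 : ℝ)) l := fun i => by
    simpa using (hp.hasSum i).summable
  refine Summable.of_norm_bounded (((hasSum_mul_left hs K).summable.add
    (hasSum_mul_right hp hs K).summable).mul_left C) fun x => ?_
  have hC : 0 ≤ C * p x.1 x.2 := (abs_nonneg _).trans (hF x)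
  have hFx := hF x
  rw [Real.norm_eq_abs]
  by_cases h1 : x.1 ∈ K <;> by_cases h2 : x.2 ∈ K <;> simp only [h1, h2, if_true, if_false, mul_one,
    add_zero, zero_add, mul_zero]
  · linarith
  · exact hFx
  · exact hFx
  · simp [hF0 x h1 h2]

lemma map_swap_of_notMem {ζ : Finset S} {a b : S} (ha : a ∉ ζ) (hb : b ∉ ζ) :
    ζ.map (Equiv.swap a b).toEmbedding = ζ := by
  ext i
  simp only [Finset.mem_map_equiv, Equiv.symm_swap]
  by_cases h1 : i = a
  · subst h1; simp [ha, hb]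
  by_cases h2 : i = b
  · subst h2; simp [ha, hb]
  rw [Equiv.swap_apply_of_ne_of_ne h1 h2]

lemma summable_holeGen (hp : IsSymmetricKernel p) {y : Finset S → ℝ} {ζ : Finset S} {M : ℝ}
    (hM : ∀ ζ', ζ'.card = ζ.card → |y ζ'| ≤ M) :
    Summable fun x : S × S =>
      p x.1 x.2 / 2 * (y (ζ.map (Equiv.swap x.1 x.2).toEmbedding) - y ζ) := by
  refine summable_of_touch hp (K := ζ) (C := M) (fun x => ?_) fun x h1 h2 => ?_
  · have h := (abs_sub _ _).trans (add_le_add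
      (hM (ζ.map (Equiv.swap x.1 x.2).toEmbedding) (by simp)) (hM ζ rfl))
    rw [abs_mul, abs_of_nonneg (div_nonneg (hp.nonneg _ _) zero_le_two)]
    calc _ ≤ p x.1 x.2 / 2 * (M + M) :=
          mul_le_mul_of_nonneg_left h (div_nonneg (hp.nonneg _ _) zero_le_two)
      _ = _ := by ring
  · rw [map_swap_of_notMem h1 h2]; simp

lemma holeGen_add_mul (hp : IsSymmetricKernel p) {y z : Finset S → ℝ} {ζ : Finset S} {M : ℝ}
    (hy : ∀ ζ', ζ'.card = ζ.card → |y ζ'| ≤ M) (hz : ∀ ζ', ζ'.card = ζ.card → |z ζ'| ≤ M) (c : ℝ) :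
    holeGen p ρ J (fun ζ' => y ζ' + c * z ζ') ζ = holeGen p ρ J y ζ + c * holeGen p ρ J z ζ := by
  have h1 := summable_holeGen hp hy
  have h2 := summable_holeGen hp hz
  unfold holeGen
  rw [mul_add, ← tsum_mul_left, Finset.mul_sum, add_add_add_comm,
    ← h1.tsum_add (h2.mul_left c), ← Finset.sum_add_distrib]
  congr 1
  · exact tsum_congr fun x => by ring
  · exact Finset.sum_congr rfl fun i _ => by ring

lemma card_boundary_le (ζ : Finset S) [DecidablePred (· ∈ B)] :
    ((J ∪ ζ.subtype (· ∈ B)).card : ℝ) ≤ J.card + ζ.card := by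
  have h1 := Finset.card_union_le J (ζ.subtype (· ∈ B))
  have h2 : (ζ.subtype (· ∈ B)).card ≤ ζ.card := by
    rw [Finset.card_subtype]; exact Finset.card_filter_le _ _
  exact_mod_cast h1.trans (by omega)

/-- The total jump rate out of `ζ` is at most `2 |ζ| + |J|`. -/
lemma mul_sub_le_holeGen (hp : IsSymmetricKernel p) (hρ : ∀ i, 0 < ρ i ∧ ρ i < 1)
    {y : Finset S → ℝ} {ζ : Finset S} {M c : ℝ} (hM : ∀ ζ', ζ'.card = ζ.card → |y ζ'| ≤ M)
    (hc : ∀ ζ', c ≤ y ζ') : (2 * ζ.card + J.card) * (c - y ζ) ≤ holeGen p ρ J y ζ := by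
  classical
  have hs : ∀ i, Summable fun l => p i l * (fun _ => (1 : ℝ)) l := fun i => by
    simpa using (hp.hasSum i).summable
  have hsum := ((hasSum_mul_left hs ζ).add (hasSum_mul_right hp hs ζ)).mul_right ((c - y ζ) / 2)
  have hrow : ∀ i, ∑' l, p i l = 1 := fun i => (hp.hasSum i).tsum_eq
  simp only [mul_one, hrow, Finset.sum_const, nsmul_eq_mul] at hsum
  have hcy : c - y ζ ≤ 0 := by linarith [hc ζ]
  have h1 : (ζ.card : ℝ) * (c - y ζ) ≤
      ∑' x : S × S, p x.1 x.2 / 2 * (y (ζ.map (Equiv.swap x.1 x.2).toEmbedding) - y ζ) := by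
    have := hsum.summable.tsum_le_tsum (fun x => ?_) (summable_holeGen hp hM)
    · rw [hsum.tsum_eq] at this
      linarith
    · have hpx := hp.nonneg x.1 x.2
      have hcx := hc (ζ.map (Equiv.swap x.1 x.2).toEmbedding)
      by_cases h1 : x.1 ∈ ζ <;> by_cases h2 : x.2 ∈ ζ <;>
        simp only [h1, h2, if_true, if_false]
      · nlinarith
      · nlinarith
      · nlinarith
      · rw [map_swap_of_notMem h1 h2]; simp
  have h2 : ((J.card : ℝ) + ζ.card) * (c - y ζ) ≤
      ∑ i ∈ J ∪ ζ.subtype (· ∈ B), (fillRate ρ J i * (y (ζ.erase i) - y ζ) +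
      (1 - fillRate ρ J i) * (y (insert (i : S) ζ) - y ζ)) := by
    calc _ ≤ ((J ∪ ζ.subtype (· ∈ B)).card : ℝ) * (c - y ζ) :=
          mul_le_mul_of_nonpos_right (card_boundary_le ζ) hcy
      _ = ∑ i ∈ J ∪ ζ.subtype (· ∈ B), (c - y ζ) := by
          rw [Finset.sum_const, nsmul_eq_mul]
      _ ≤ _ := Finset.sum_le_sum fun i _ => by
          have e1 := mul_le_mul_of_nonneg_left (sub_le_sub_right (hc (ζ.erase i)) (y ζ))
            (fillRate_nonneg (J := J) hρ i)
          have e2 := mul_le_mul_of_nonneg_left (sub_le_sub_right (hc (insert (i : S) ζ)) (y ζ))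
            (sub_nonneg.2 (fillRate_le_one (J := J) hρ i))
          linarith
  unfold holeGen
  calc _ = (ζ.card : ℝ) * (c - y ζ) + ((J.card : ℝ) + ζ.card) * (c - y ζ) := by ring
    _ ≤ _ := by convert add_le_add h1 h2

lemma sum_map_swap_sub_le {β : S → ℝ} (hβ0 : ∀ i, 0 ≤ β i) (ζ : Finset S) (a b : S) :
    (∑ i ∈ ζ.map (Equiv.swap a b).toEmbedding, β i) - ∑ i ∈ ζ, β i ≤
      (if a ∈ ζ then β b else 0) + if b ∈ ζ then β a else 0 := by
  have hsub : ζ.map (Equiv.swap a b).toEmbedding ⊆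
      ζ ∪ ((if a ∈ ζ then {b} else ∅) ∪ if b ∈ ζ then {a} else ∅) := by
    intro i hi
    simp only [Finset.mem_map_equiv, Equiv.symm_swap] at hi
    by_cases h1 : i = a
    · subst h1
      rw [Equiv.swap_apply_left] at hi
      simp [hi]
    by_cases h2 : i = b
    · subst h2
      rw [Equiv.swap_apply_right] at hi
      simp [hi]
    rw [Equiv.swap_apply_of_ne_of_ne h1 h2] at hi
    simp [hi]
  have h1 := Finset.sum_le_sum_of_subset_of_nonneg hsub fun i _ _ => hβ0 i
  have hun : ∀ s t : Finset S, ∑ i ∈ s ∪ t, β i ≤ ∑ i ∈ s, β i + ∑ i ∈ t, β i := fun s t => by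
    rw [← Finset.sum_union_inter]
    exact le_add_of_nonneg_right (Finset.sum_nonneg fun i _ => hβ0 i)
  have h2 := hun ζ ((if a ∈ ζ then {b} else ∅) ∪ if b ∈ ζ then {a} else ∅)
  have h3 := hun (if a ∈ ζ then {b} else ∅) (if b ∈ ζ then {a} else ∅)
  have e1 : ∑ i ∈ (if a ∈ ζ then ({b} : Finset S) else ∅), β i = if a ∈ ζ then β b else 0 := by
    split_ifs <;> simp
  have e2 : ∑ i ∈ (if b ∈ ζ then ({a} : Finset S) else ∅), β i = if b ∈ ζ then β a else 0 := by
    split_ifs <;> simp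
  linarith

lemma holeGen_weight_le (hp : IsSymmetricKernel p) (hρ : ∀ i, 0 < ρ i ∧ ρ i < 1) {β : S → ℝ}
    (hβ0 : ∀ i, 0 ≤ β i) {C : ℝ} (hβC : ∀ i, β i ≤ C)
    (hβ : ∀ i, ∑' l, p i l * β l ≤ 2 * β i) (ζ : Finset S) :
    holeGen p ρ J (weight β J) ζ ≤ 3 * weight β J ζ := by
  classical
  have hs := summable_mul_of_bounded hp hβ0 hβC
  have hsum := ((hasSum_mul_left hs ζ).add (hasSum_mul_right hp hs ζ)).mul_right (1 / 2)
  have hM : ∀ ζ', ζ'.card = ζ.card → |weight β J ζ'| ≤ (ζ.card + J.card) * C := fun ζ' h => by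
    rw [← h]; exact abs_weight_le hβ0 hβC ζ'
  have h1 : ∑' x : S × S, p x.1 x.2 / 2 * (weight β J (ζ.map (Equiv.swap x.1 x.2).toEmbedding) -
      weight β J ζ) ≤ 2 * ∑ i ∈ ζ, β i := by
    have h := (summable_holeGen hp hM).tsum_le_tsum (fun x => ?_) hsum.summable
    · rw [hsum.tsum_eq] at h
      have h' : ∑ i ∈ ζ, ∑' l, p i l * β l ≤ ∑ i ∈ ζ, 2 * β i := Finset.sum_le_sum fun i _ => hβ i
      rw [← Finset.mul_sum] at h'
      linarith
    · have hpx := hp.nonneg x.1 x.2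
      have h := mul_le_mul_of_nonneg_left (sum_map_swap_sub_le hβ0 ζ x.1 x.2)
        (div_nonneg hpx zero_le_two)
      unfold weight
      rw [add_sub_add_right_eq_sub]
      refine h.trans (le_of_eq ?_)
      split_ifs <;> ring
  have h2 : ∑ i ∈ J ∪ ζ.subtype (· ∈ B), (fillRate ρ J i * (weight β J (ζ.erase i) - weight β J ζ) +
      (1 - fillRate ρ J i) * (weight β J (insert (i : S) ζ) - weight β J ζ)) ≤ ∑ j ∈ J, β j := by
    calc _ ≤ ∑ i ∈ J ∪ ζ.subtype (· ∈ B), if i ∈ J then β i else 0 :=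
          Finset.sum_le_sum fun i _ => ?_
      _ = _ := by rw [Finset.sum_ite_mem, Finset.union_inter_cancel_left]
    have e1 : weight β J (ζ.erase i) - weight β J ζ ≤ 0 := by
      have := Finset.sum_le_sum_of_subset_of_nonneg (Finset.erase_subset (i : S) ζ)
        fun k _ _ => hβ0 k
      unfold weight
      linarith
    have e2 : weight β J (insert (i : S) ζ) - weight β J ζ ≤ β i := by
      unfold weight
      by_cases hi : (i : S) ∈ ζ
      · rw [Finset.insert_eq_of_mem hi, sub_self]
        exact hβ0 i
      · rw [Finset.sum_insert hi]
        linarith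
    have e3 := mul_nonpos_of_nonneg_of_nonpos (fillRate_nonneg (J := J) hρ i) e1
    split_ifs with hi
    · have e4 := mul_le_mul_of_nonneg_left e2 (sub_nonneg.2 (fillRate_le_one (J := J) hρ i))
      have e5 := mul_nonneg (fillRate_nonneg (J := J) hρ i) (hβ0 i)
      linarith
    · have e4 : fillRate ρ J i = 1 := if_neg hi
      rw [e4] at e3 ⊢
      linarith
  have hJ : 0 ≤ ∑ j ∈ J, β j := Finset.sum_nonneg fun j _ => hβ0 j
  have hζ : 0 ≤ ∑ j ∈ ζ, β j := Finset.sum_nonneg fun j _ => hβ0 j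
  unfold holeGen
  have : weight β J ζ = ∑ i ∈ ζ, β i + ∑ j ∈ J, β j := rfl
  calc _ ≤ 2 * ∑ i ∈ ζ, β i + ∑ j ∈ J, β j := by convert add_le_add h1 h2
    _ ≤ _ := by rw [this]; linarith

lemma holeGen_comparison_of_pos (hp : IsSymmetricKernel p) (hρ : ∀ i, 0 < ρ i ∧ ρ i < 1)
    {y : ℝ → Finset S → ℝ} {T M : ℝ}
    (hcont : ∀ ζ, ContinuousOn (fun s => y s ζ) (Set.Icc 0 T))
    (hderiv : ∀ ζ, ∀ s ∈ Set.Ico 0 T,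
      HasDerivWithinAt (fun r => y r ζ) (holeGen p ρ J (y s) ζ) (Set.Ici s) s)
    (hM : ∀ s ζ, |y s ζ| ≤ M)
    {β : S → ℝ} {δ C : ℝ} (hδ0 : 0 < δ) (hδ : ∀ i, δ ≤ β i) (hβC : ∀ i, β i ≤ C)
    (hβ : ∀ i, ∑' l, p i l * β l ≤ 2 * β i) (h0 : ∀ ζ, -weight β J ζ ≤ y 0 ζ) (ζ : Finset S) :
    ∀ s ∈ Set.Icc 0 T, 0 ≤ y s ζ + Real.exp (3 * s) * weight β J ζ := by
  have hM0 : 0 ≤ M := (abs_nonneg _).trans (hM 0 ∅)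
  have hβ0 : ∀ i, 0 ≤ β i := fun i => hδ0.le.trans (hδ i)
  have hW0 : ∀ ζ, 0 ≤ weight β J ζ := weight_nonneg hβ0
  have hexp1 : ∀ s ∈ Set.Icc 0 T, (1 : ℝ) ≤ Real.exp (3 * s) := fun s hs =>
    Real.one_le_exp (by linarith [hs.1])
  have hexp : ∀ r : ℝ, HasDerivAt (fun r => Real.exp (3 * r)) (Real.exp (3 * r) * 3) r := by
    intro r
    simpa using ((hasDerivAt_id r).const_mul 3).exp
  refine nonneg_of_deriv_right (Λ := 2 * (M / δ) + J.card) (M := M)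
    (u := fun ζ s => y s ζ + Real.exp (3 * s) * weight β J ζ)
    (u' := fun ζ s => holeGen p ρ J (y s) ζ + Real.exp (3 * s) * 3 * weight β J ζ)
    (by positivity) hM0 (fun ζ => ?_) (fun ζ s hs => ?_) (fun ζ => ?_) (fun ζ s hs => ?_)
    (fun ζ => ?_) ζ
  · exact (hcont ζ).add (Continuous.continuousOn (by fun_prop))
  · exact (hderiv ζ s hs).add ((hexp s).mul_const _).hasDerivWithinAt
  · have := h0 ζ
    simp only [mul_zero, Real.exp_zero, one_mul]
    linarith
  · have h1 := mul_nonneg (Real.exp_pos (3 * s)).le (hW0 ζ)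
    have h2 := neg_le_of_abs_le (hM s ζ)
    change -M ≤ y s ζ + Real.exp (3 * s) * weight β J ζ
    linarith
  · -- large sets are controlled by the weight, small ones have a bounded jump rate
    rcases le_or_gt M (ζ.card * δ) with hlarge | hsmall
    · left
      intro s hs
      have h1 := le_mul_of_one_le_left (hW0 ζ) (hexp1 s hs)
      have h2 := neg_le_of_abs_le (hM s ζ)
      have h3 := le_weight (J := J) hβ0 hδ ζ
      change 0 ≤ y s ζ + Real.exp (3 * s) * weight β J ζ
      linarith
    · right
      intro s hs c _ hcu
      have hs' : s ∈ Set.Icc 0 T := ⟨hs.1, hs.2.le⟩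
      have hW : ∀ ζ' : Finset S, ζ'.card = ζ.card →
          |weight β J ζ'| ≤ (ζ.card + J.card) * C := fun ζ' h => by
        rw [← h]; exact abs_weight_le hβ0 hβC ζ'
      have hK : 0 ≤ (ζ.card + J.card) * C := (abs_nonneg _).trans (hW ζ rfl)
      have h1 := holeGen_add_mul (ρ := ρ) (J := J) hp (ζ := ζ) (y := y s) (z := weight β J)
        (M := M + (ζ.card + J.card) * C) (fun ζ' _ => (hM s ζ').trans (by linarith))
        (fun ζ' h => (hW ζ' h).trans (by linarith)) (Real.exp (3 * s))
      have h2 := mul_le_mul_of_nonneg_left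
        (holeGen_weight_le (J := J) hp hρ hβ0 hβC hβ ζ) (Real.exp_pos (3 * s)).le
      have h3 := mul_sub_le_holeGen (ρ := ρ) (J := J) hp hρ (ζ := ζ)
        (y := fun ζ' => y s ζ' + Real.exp (3 * s) * weight β J ζ')
        (M := M + Real.exp (3 * s) * ((ζ.card + J.card) * C)) (c := c) (fun ζ' h => by
          refine (abs_add_le _ _).trans (add_le_add (hM s ζ') ?_)
          rw [abs_mul, abs_of_pos (Real.exp_pos _)]
          exact mul_le_mul_of_nonneg_left (hW ζ' h) (Real.exp_pos _).le) hcu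
      have h4 : (ζ.card : ℝ) ≤ M / δ := by
        rw [le_div_iff₀ hδ0]; exact hsmall.le
      have h5 : (2 * (M / δ) + J.card) * (c - (y s ζ + Real.exp (3 * s) * weight β J ζ)) ≤
          (2 * ζ.card + J.card) * (c - (y s ζ + Real.exp (3 * s) * weight β J ζ)) :=
        mul_le_mul_of_nonpos_right (by linarith) (sub_nonpos.2 (hcu ζ))
      change (2 * (M / δ) + J.card) * (c - (y s ζ + Real.exp (3 * s) * weight β J ζ)) ≤
        holeGen p ρ J (y s) ζ + Real.exp (3 * s) * 3 * weight β J ζ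
      linarith

/-- Comparison for bounded solutions of the backward equation of the hole process: a lower bound
by minus the weight of an excessive function persists, up to an exponential factor. As `β = 0` is
allowed, bounded solutions preserve positivity and are determined by their initial values. -/
lemma holeGen_comparison (hp : IsSymmetricKernel p) (hρ : ∀ i, 0 < ρ i ∧ ρ i < 1)
    {y : ℝ → Finset S → ℝ} {T M : ℝ} (hT : 0 ≤ T)
    (hcont : ∀ ζ, ContinuousOn (fun s => y s ζ) (Set.Icc 0 T))
    (hderiv : ∀ ζ, ∀ s ∈ Set.Ico 0 T,
      HasDerivWithinAt (fun r => y r ζ) (holeGen p ρ J (y s) ζ) (Set.Ici s) s)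
    (hM : ∀ s ζ, |y s ζ| ≤ M)
    {β : S → ℝ} {C : ℝ} (hβ0 : ∀ i, 0 ≤ β i) (hβC : ∀ i, β i ≤ C)
    (hβ : ∀ i, ∑' l, p i l * β l ≤ 2 * β i) (h0 : ∀ ζ, -weight β J ζ ≤ y 0 ζ) (ζ : Finset S) :
    -(Real.exp (3 * T) * weight β J ζ) ≤ y T ζ := by
  have hW : ∀ (δ : ℝ) (ζ : Finset S),
      weight (fun i => β i + δ) J ζ = weight β J ζ + (ζ.card + J.card) * δ := by
    intro δ ζ
    simp only [weight, Finset.sum_add_distrib, Finset.sum_const, nsmul_eq_mul]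
    ring
  have key : ∀ δ > 0, -(Real.exp (3 * T) * weight β J ζ) ≤
      y T ζ + Real.exp (3 * T) * ((ζ.card + J.card) * δ) := by
    intro δ hδ
    have h := holeGen_comparison_of_pos (J := J) hp hρ hcont hderiv hM (β := fun i => β i + δ)
      (C := C + δ) hδ (fun i => by linarith [hβ0 i]) (fun i => by linarith [hβC i])
      (fun i => ?_) (fun ζ => ?_) ζ T ⟨hT, le_rfl⟩
    · rw [hW] at h
      linarith
    · have e : ∑' l, p i l * (β l + δ) = ∑' l, p i l * β l + δ := by
        simp_rw [mul_add]
        rw [(summable_mul_of_bounded hp hβ0 hβC i).tsum_add ((hp.hasSum i).summable.mul_right δ),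
          tsum_mul_right, (hp.hasSum i).tsum_eq, one_mul]
      rw [e]
      linarith [hβ i]
    · rw [hW]
      have : 0 ≤ ((ζ.card : ℝ) + J.card) * δ := by positivity
      linarith [h0 ζ]
  refine le_of_forall_pos_le_add fun ε hε => ?_
  have hA : 0 ≤ Real.exp (3 * T) * (ζ.card + J.card) := by positivity
  refine (key (ε / (Real.exp (3 * T) * (ζ.card + J.card) + 1)) (by positivity)).trans ?_
  have : Real.exp (3 * T) * ((ζ.card + J.card) *
      (ε / (Real.exp (3 * T) * (ζ.card + J.card) + 1))) ≤ ε := by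
    rw [← mul_assoc, mul_div_assoc', div_le_iff₀ (by positivity)]
    nlinarith
  linarith

end Hole

/-! ### The generators on products of occupation variables -/

section Config

variable {S : Type*} {p : S → S → ℝ} {B : Set S} {ρ : B → ℝ} {J : Finset B}

lemma occ_nonneg (b : Bool) : 0 ≤ occ b := by cases b <;> simp [occ]

lemma occ_le_one (b : Bool) : occ b ≤ 1 := by cases b <;> simp [occ]

lemma measurable_occ : Measurable occ := measurable_from_top

/-- The function `∏_{i ∈ ζ} (1 - ξ(i)) · ∏_{j ∈ J} ρ_j ^ ξ(j_e)`: the indicator that the sites of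
`ζ` are empty, with every particle in a sink of `J` weighted by the density of its reservoir. -/
def hole (ρ : B → ℝ) (J : Finset B) (ζ : Finset S) (ξ : DualConfig S B) : ℝ :=
  (∏ i ∈ ζ, (1 - occ (ξ.1 i))) * ∏ j ∈ J, ρ j ^ ξ.2 j

lemma prod_sink_nonneg (hρ : ∀ i, 0 < ρ i ∧ ρ i < 1) (n : B → ℕ) : 0 ≤ ∏ j ∈ J, ρ j ^ n j :=
  Finset.prod_nonneg fun j _ => pow_nonneg (hρ j).1.le _

lemma prod_sink_le_one (hρ : ∀ i, 0 < ρ i ∧ ρ i < 1) (n : B → ℕ) : ∏ j ∈ J, ρ j ^ n j ≤ 1 :=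
  Finset.prod_le_one (fun j _ => pow_nonneg (hρ j).1.le _)
    fun j _ => pow_le_one₀ (hρ j).1.le (hρ j).2.le

lemma hole_nonneg (hρ : ∀ i, 0 < ρ i ∧ ρ i < 1) (ζ : Finset S) (ξ : DualConfig S B) :
    0 ≤ hole ρ J ζ ξ :=
  mul_nonneg (Finset.prod_nonneg fun _ _ => sub_nonneg.2 (occ_le_one _)) (prod_sink_nonneg hρ _)

lemma hole_le_one (hρ : ∀ i, 0 < ρ i ∧ ρ i < 1) (ζ : Finset S) (ξ : DualConfig S B) :
    hole ρ J ζ ξ ≤ 1 :=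
  mul_le_one₀ (Finset.prod_le_one (fun _ _ => sub_nonneg.2 (occ_le_one _))
    fun _ _ => sub_le_self _ (occ_nonneg _)) (prod_sink_nonneg hρ _) (prod_sink_le_one hρ _)

lemma abs_hole_le_one (hρ : ∀ i, 0 < ρ i ∧ ρ i < 1) (ζ : Finset S) (ξ : DualConfig S B) :
    |hole ρ J ζ ξ| ≤ 1 :=
  abs_le.2 ⟨by linarith [hole_nonneg (J := J) hρ ζ ξ], hole_le_one hρ ζ ξ⟩

lemma measurable_hole (ρ : B → ℝ) (J : Finset B) (ζ : Finset S) : Measurable (hole ρ J ζ) := by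
  refine Measurable.mul (Finset.measurable_prod _ fun i _ => ?_)
    (Finset.measurable_prod _ fun j _ => ?_)
  · exact measurable_const.sub (measurable_occ.comp ((measurable_pi_apply i).comp measurable_fst))
  · exact measurable_const.pow ((measurable_pi_apply j).comp measurable_snd)

lemma hole_mem_dualLocalFunctions (hρ : ∀ i, 0 < ρ i ∧ ρ i < 1) (ζ : Finset S) :
    hole ρ J ζ ∈ dualLocalFunctions S B := by
  refine ⟨⟨ζ, J, fun ξ ξ' h1 h2 => ?_⟩, 1, abs_hole_le_one hρ ζ⟩
  unfold hole
  congr 1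
  · exact Finset.prod_congr rfl fun i hi => by rw [h1 i hi]
  · exact Finset.prod_congr rfl fun j hj => by rw [h2 j hj]

variable [DecidableEq S]

lemma move_eq_comp_swap {η : Config S} {a b : S} (ha : η a = true) (hb : η b = false) :
    move η a b = η ∘ Equiv.swap a b := by
  funext i
  simp only [move, Function.comp]
  by_cases h2 : i = b
  · subst h2; simp [ha]
  by_cases h1 : i = a
  · subst h1; simp [hb, h2]
  · simp [h1, h2, Equiv.swap_apply_of_ne_of_ne h1 h2]

lemma comp_swap_of_eq {η : Config S} {a b : S} (h : η a = η b) : η ∘ Equiv.swap a b = η := by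
  funext i
  simp only [Function.comp]
  by_cases h1 : i = a
  · subst h1; simp [h]
  by_cases h2 : i = b
  · subst h2; simp [h]
  rw [Equiv.swap_apply_of_ne_of_ne h1 h2]

lemma summable_stirring (hp : IsSymmetricKernel p) {g : Config S → ℝ} {K : Finset S}
    (hg : ∀ η η' : Config S, (∀ i ∈ K, η i = η' i) → g η = g η') {C : ℝ} (hC : ∀ η, |g η| ≤ C)
    (η : Config S) :
    Summable fun x : S × S => p x.1 x.2 / 2 * (g (η ∘ Equiv.swap x.1 x.2) - g η) := by
  refine summable_of_touch hp (K := K) (C := C) (fun x => ?_) fun x h1 h2 => ?_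
  · have h := (abs_sub _ _).trans (add_le_add (hC (η ∘ Equiv.swap x.1 x.2)) (hC η))
    rw [abs_mul, abs_of_nonneg (div_nonneg (hp.nonneg _ _) zero_le_two)]
    calc _ ≤ p x.1 x.2 / 2 * (C + C) :=
          mul_le_mul_of_nonneg_left h (div_nonneg (hp.nonneg _ _) zero_le_two)
      _ = _ := by ring
  · rw [hg (η ∘ Equiv.swap x.1 x.2) η, sub_self, mul_zero]
    intro i hi
    have e1 : i ≠ x.1 := fun h => h1 (h ▸ hi)
    have e2 : i ≠ x.2 := fun h => h2 (h ▸ hi)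
    simp [Equiv.swap_apply_of_ne_of_ne e1 e2]

/-- Stirring form of the exclusion generator. As `p` is symmetric, the particle moves from `i` to
`l` and from `l` to `i` combine into an exchange of the contents of `i` and `l`. -/
lemma tsum_exclusion_eq_stirring (hp : IsSymmetricKernel p) {g : Config S → ℝ} {K : Finset S}
    (hg : ∀ η η' : Config S, (∀ i ∈ K, η i = η' i) → g η = g η') {C : ℝ} (hC : ∀ η, |g η| ≤ C)
    (η : Config S) :
    ∑' x : S × S, p x.1 x.2 * (occ (η x.1) * (1 - occ (η x.2))) * (g (move η x.1 x.2) - g η) =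
      ∑' x : S × S, p x.1 x.2 / 2 * (g (η ∘ Equiv.swap x.1 x.2) - g η) := by
  set a : S × S → ℝ := fun x =>
    p x.1 x.2 * (occ (η x.1) * (1 - occ (η x.2))) * (g (move η x.1 x.2) - g η) with ha
  set b : S × S → ℝ := fun x => p x.1 x.2 / 2 * (g (η ∘ Equiv.swap x.1 x.2) - g η) with hb
  have hsb : Summable b := summable_stirring hp hg hC η
  have hab : ∀ x, a x = 2 * (occ (η x.1) * (1 - occ (η x.2))) * b x := by
    intro x
    simp only [ha, hb]
    rcases h1 : η x.1 with _ | _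
    · simp [occ]
    rcases h2 : η x.2 with _ | _
    · rw [move_eq_comp_swap h1 h2]; ring
    · simp [occ]
  have hsa : Summable a := by
    refine Summable.of_norm_bounded (hsb.abs.mul_left 2) fun x => ?_
    rw [hab, Real.norm_eq_abs, abs_mul]
    gcongr
    cases η x.1 <;> cases η x.2 <;> simp [occ]
  have hswap : ∀ x, a x + a x.swap = 2 * b x := by
    intro x
    have hbs : b x.swap = b x := by
      simp only [hb, Prod.fst_swap, Prod.snd_swap]
      rw [Equiv.swap_comm, hp.symm]
    rw [hab, hab, hbs, Prod.fst_swap, Prod.snd_swap]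
    rcases h1 : η x.1 with _ | _ <;> rcases h2 : η x.2 with _ | _
    · have : b x = 0 := by simp only [hb]; rw [comp_swap_of_eq (h1.trans h2.symm)]; simp
      simp [this]
    · simp [occ]
    · simp [occ]
    · have : b x = 0 := by simp only [hb]; rw [comp_swap_of_eq (h1.trans h2.symm)]; simp
      simp [this]
  have hs' : Summable fun x : S × S => a x.swap := (Equiv.prodComm S S).summable_iff.2 hsa
  have e1 : ∑' x : S × S, a x.swap = ∑' x, a x := (Equiv.prodComm S S).tsum_eq a
  have e2 := hsa.tsum_add hs'
  rw [e1, tsum_congr hswap, tsum_mul_left] at e2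
  linarith

lemma hole_comp_swap (ρ : B → ℝ) (J : Finset B) (ζ : Finset S) (ξ : DualConfig S B) (a b : S) :
    hole ρ J ζ (ξ.1 ∘ Equiv.swap a b, ξ.2) = hole ρ J (ζ.map (Equiv.swap a b).toEmbedding) ξ := by
  simp [hole]

lemma hole_absorb (ρ : B → ℝ) (J : Finset B) (ζ : Finset S) (ξ : DualConfig S B) (i : B) :
    hole ρ J ζ (absorb ξ i) = fillRate ρ J i * hole ρ J (ζ.erase i) ξ := by
  have h1 : ∏ k ∈ ζ, (1 - occ ((absorb ξ i).1 k)) = ∏ k ∈ ζ.erase i, (1 - occ (ξ.1 k)) := by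
    have h : ∀ k ∈ ζ.erase i, 1 - occ ((absorb ξ i).1 k) = 1 - occ (ξ.1 k) := fun k hk => by
      simp [absorb, Function.update_of_ne (Finset.ne_of_mem_erase hk)]
    rw [← Finset.prod_congr rfl h]
    refine (Finset.prod_subset (Finset.erase_subset _ _) fun k hk hk' => ?_).symm
    have : k = i := by
      by_contra hne
      exact hk' (Finset.mem_erase.2 ⟨hne, hk⟩)
    subst this
    simp [absorb, occ]
  have h2 : ∏ j ∈ J, ρ j ^ (absorb ξ i).2 j = fillRate ρ J i * ∏ j ∈ J, ρ j ^ ξ.2 j := by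
    have h : ∀ j ∈ J, ρ j ^ (absorb ξ i).2 j = (if i = j then ρ j else 1) * ρ j ^ ξ.2 j := by
      intro j _
      by_cases hj : i = j
      · subst hj; simp [absorb, pow_succ, mul_comm]
      · simp [absorb, hj, Function.update_of_ne (Ne.symm hj)]
    rw [Finset.prod_congr rfl h, Finset.prod_mul_distrib, Finset.prod_ite_eq, fillRate]
  rw [hole, h1, h2, hole]
  ring

/-- Absorption of a particle at `i` acts on `hole` as the filling or the creation of a hole at
`i`. -/
lemma occ_mul_hole_absorb_sub (ρ : B → ℝ) (J : Finset B) (ζ : Finset S) (ξ : DualConfig S B)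
    (i : B) :
    occ (ξ.1 i) * (hole ρ J ζ (absorb ξ i) - hole ρ J ζ ξ) =
      fillRate ρ J i * (hole ρ J (ζ.erase i) ξ - hole ρ J ζ ξ) +
        (1 - fillRate ρ J i) * (hole ρ J (insert (i : S) ζ) ξ - hole ρ J ζ ξ) := by
  rw [hole_absorb]
  by_cases hi : (i : S) ∈ ζ
  · have h1 : hole ρ J ζ ξ = (1 - occ (ξ.1 i)) * hole ρ J (ζ.erase i) ξ := by
      unfold hole
      rw [← Finset.mul_prod_erase _ _ hi, mul_assoc]
    rw [Finset.insert_eq_of_mem hi, h1]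
    rcases ξ.1 i with _ | _ <;> simp [occ]
  · have h1 : hole ρ J (insert (i : S) ζ) ξ = (1 - occ (ξ.1 i)) * hole ρ J ζ ξ := by
      unfold hole
      rw [Finset.prod_insert hi, mul_assoc]
    rw [Finset.erase_eq_of_notMem hi, h1]
    rcases ξ.1 i with _ | _ <;> simp [occ]
    ring

/-- The dual generator acts on `hole` as the generator of the hole process does. -/
lemma dualGen_hole (hp : IsSymmetricKernel p) (hρ : ∀ i, 0 < ρ i ∧ ρ i < 1) (ζ : Finset S)
    (ξ : DualConfig S B) :
    dualGen p B (hole ρ J ζ) ξ = holeGen p ρ J (fun ζ' => hole ρ J ζ' ξ) ζ := by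
  classical
  unfold dualGen holeGen
  congr 1
  · have h := tsum_exclusion_eq_stirring hp (g := fun η => hole ρ J ζ (η, ξ.2)) (K := ζ) (C := 1)
      (fun η η' h => by
        simp only [hole]
        congr 1
        exact Finset.prod_congr rfl fun i hi => by rw [h i hi])
      (fun η => abs_hole_le_one hρ ζ _) ξ.1
    refine h.trans (tsum_congr fun x => ?_)
    rw [hole_comp_swap]
  · rw [tsum_congr (occ_mul_hole_absorb_sub ρ J ζ ξ)]
    refine (tsum_eq_sum (s := J ∪ ζ.subtype (· ∈ B)) fun i hi => ?_).trans (by congr!)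
    simp only [Finset.mem_union, Finset.mem_subtype, not_or] at hi
    simp [fillRate, hi.1, Finset.erase_eq_of_notMem hi.2]

lemma integral_holeGen_hole [Countable S] (hp : IsSymmetricKernel p)
    (hρ : ∀ i, 0 < ρ i ∧ ρ i < 1) (μ : Measure (DualConfig S B)) [IsProbabilityMeasure μ]
    (ζ : Finset S) :
    ∫ ξ, holeGen p ρ J (fun ζ' => hole ρ J ζ' ξ) ζ ∂μ =
      holeGen p ρ J (fun ζ' => ∫ ξ, hole ρ J ζ' ξ ∂μ) ζ := by
  classical
  have hint : ∀ ζ', Integrable (hole ρ J ζ') μ := fun ζ' =>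
    integrable_of_bounded (measurable_hole ρ J ζ') (abs_hole_le_one hρ ζ')
  -- only the rates of the exchanges that affect `ζ` are summable
  set c : S × S → ℝ := fun x => if x.1 ∈ ζ ∨ x.2 ∈ ζ then p x.1 x.2 / 2 else 0 with hc
  have hc0 : ∀ x, 0 ≤ c x := fun x => by
    simp only [hc]; split_ifs
    · exact div_nonneg (hp.nonneg _ _) zero_le_two
    · exact le_rfl
  have hcs : Summable c := by
    refine summable_of_touch hp (K := ζ) (C := 1) (fun x => ?_) fun x h1 h2 => by simp [hc, h1, h2]
    rw [abs_of_nonneg (hc0 x)]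
    have := hp.nonneg x.1 x.2
    simp only [hc]; split_ifs <;> linarith
  have hcy : ∀ (y : Finset S → ℝ) x,
      p x.1 x.2 / 2 * (y (ζ.map (Equiv.swap x.1 x.2).toEmbedding) - y ζ) =
        c x * (y (ζ.map (Equiv.swap x.1 x.2).toEmbedding) - y ζ) := by
    intro y x
    simp only [hc]
    split_ifs with h
    · rfl
    · rw [not_or] at h
      rw [map_swap_of_notMem h.1 h.2]; simp
  have hmeas : ∀ x : S × S, Measurable fun ξ =>
      hole ρ J (ζ.map (Equiv.swap x.1 x.2).toEmbedding) ξ - hole ρ J ζ ξ := fun x =>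
    (measurable_hole ρ J _).sub (measurable_hole ρ J _)
  have hbd : ∀ (x : S × S) ξ,
      |hole ρ J (ζ.map (Equiv.swap x.1 x.2).toEmbedding) ξ - hole ρ J ζ ξ| ≤ 1 := fun x ξ => by
    have h1 := hole_nonneg (J := J) hρ (ζ.map (Equiv.swap x.1 x.2).toEmbedding) ξ
    have h2 := hole_le_one (J := J) hρ (ζ.map (Equiv.swap x.1 x.2).toEmbedding) ξ
    have h3 := hole_nonneg (J := J) hρ ζ ξ
    have h4 := hole_le_one (J := J) hρ ζ ξ
    exact abs_le.2 ⟨by linarith, by linarith⟩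
  have hcy' : (fun ξ => ∑' x : S × S, p x.1 x.2 / 2 *
      (hole ρ J (ζ.map (Equiv.swap x.1 x.2).toEmbedding) ξ - hole ρ J ζ ξ)) = fun ξ =>
      ∑' x : S × S, c x * (hole ρ J (ζ.map (Equiv.swap x.1 x.2).toEmbedding) ξ - hole ρ J ζ ξ) :=
    funext fun ξ => tsum_congr fun x => hcy (fun ζ' => hole ρ J ζ' ξ) x
  unfold holeGen
  rw [integral_add]
  · congr 1
    · rw [hcy', integral_tsum_mul hcs hc0 hmeas hbd]
      refine tsum_congr fun x => ?_
      rw [integral_sub (hint _) (hint _), hcy fun ζ' => ∫ ξ, hole ρ J ζ' ξ ∂μ]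
    · rw [integral_finsetSum]
      · refine Finset.sum_congr rfl fun i _ => ?_
        beta_reduce
        rw [integral_add, integral_const_mul, integral_const_mul, integral_sub (hint _) (hint _),
          integral_sub (hint _) (hint _)]
        · exact ((hint _).sub (hint _)).const_mul _
        · exact ((hint _).sub (hint _)).const_mul _
      · exact fun i _ => (((hint _).sub (hint _)).const_mul _).add
          (((hint _).sub (hint _)).const_mul _)
  · rw [hcy']
    exact integrable_tsum_mul hcs hc0 hmeas hbd
  · exact integrable_finsetSum _ fun i _ => (((hint _).sub (hint _)).const_mul _).add
          (((hint _).sub (hint _)).const_mul _)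

end Config

/-! ### Consequences of the comparison for the dual process -/

section Dual

variable {S : Type*} [DecidableEq S] {p : S → S → ℝ} {B : Set S} {ρ : B → ℝ} {J : Finset B}
  {Q : ℝ≥0 → Kernel (DualConfig S B) (DualConfig S B)}

lemma continuousOn_integral_hole (hρ : ∀ i, 0 < ρ i ∧ ρ i < 1)
    (hQ : IsMarkovProcess Q) (hQgen : HasGeneratorOn Q (dualLocalFunctions S B) (dualGen p B))
    (ξ : DualConfig S B) (ζ : Finset S) (A : Set ℝ) :
    ContinuousOn (fun r : ℝ => ∫ ξ', hole ρ J ζ ξ' ∂(Q r.toNNReal ξ)) A :=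
  continuousOn_integral hQ (hQgen _ (hole_mem_dualLocalFunctions (J := J) hρ ζ))
    (measurable_hole ρ J ζ) (abs_hole_le_one hρ ζ) ξ A

variable [Countable S]

/-- The backward equation of the hole process, satisfied by the expectations of `hole` under the
dual process. -/
lemma hasDerivWithinAt_integral_hole (hp : IsSymmetricKernel p) (hρ : ∀ i, 0 < ρ i ∧ ρ i < 1)
    (hQ : IsMarkovProcess Q) (hQgen : HasGeneratorOn Q (dualLocalFunctions S B) (dualGen p B))
    (ξ : DualConfig S B) (ζ : Finset S) {s : ℝ} (hs : 0 ≤ s) :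
    HasDerivWithinAt (fun r : ℝ => ∫ ξ', hole ρ J ζ ξ' ∂(Q r.toNNReal ξ))
      (holeGen p ρ J (fun ζ' => ∫ ξ', hole ρ J ζ' ξ' ∂(Q s.toNNReal ξ)) ζ) (Set.Ici s) s := by
  have := hQ.markov
  have h := hasDerivWithinAt_integral hQ (hQgen _ (hole_mem_dualLocalFunctions (J := J) hρ ζ))
    (measurable_hole ρ J ζ) (abs_hole_le_one hρ ζ) ξ hs
  simp only [dualGen_hole hp hρ] at h
  rwa [integral_holeGen_hole hp hρ] at h

/-- Continuity of the dual process in its initial state: a bound on the initial difference of the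
`hole` functions persists. -/
lemma integral_hole_sub_le (hp : IsSymmetricKernel p) (hρ : ∀ i, 0 < ρ i ∧ ρ i < 1)
    (hQ : IsMarkovProcess Q) (hQgen : HasGeneratorOn Q (dualLocalFunctions S B) (dualGen p B))
    {ξ ξ' : DualConfig S B} {β : S → ℝ} {C : ℝ} (hβ0 : ∀ i, 0 ≤ β i) (hβC : ∀ i, β i ≤ C)
    (hβ : ∀ i, ∑' l, p i l * β l ≤ 2 * β i)
    (h0 : ∀ ζ, hole ρ J ζ ξ ≤ hole ρ J ζ ξ' + weight β J ζ) (ζ : Finset S) (t : ℝ≥0) :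
    ∫ x, hole ρ J ζ x ∂(Q t ξ) ≤
      ∫ x, hole ρ J ζ x ∂(Q t ξ') + Real.exp (3 * t) * weight β J ζ := by
  have := hQ.markov
  have hb : ∀ (t : ℝ≥0) (ξ : DualConfig S B) ζ, |∫ x, hole ρ J ζ x ∂(Q t ξ)| ≤ 1 := fun t ξ ζ =>
    abs_integral_le (abs_hole_le_one hρ ζ)
  have h := holeGen_comparison (ρ := ρ) (J := J) hp hρ (T := t) (M := 2)
    (y := fun s ζ => (∫ x, hole ρ J ζ x ∂(Q s.toNNReal ξ')) +
      (-1) * ∫ x, hole ρ J ζ x ∂(Q s.toNNReal ξ)) t.2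
    (fun ζ => (continuousOn_integral_hole hρ hQ hQgen ξ' ζ _).add
      (continuousOn_const.mul (continuousOn_integral_hole hρ hQ hQgen ξ ζ _)))
    (fun ζ s hs => by
      rw [holeGen_add_mul hp (M := 1) (fun _ _ => hb _ _ _) (fun _ _ => hb _ _ _)]
      exact (hasDerivWithinAt_integral_hole hp hρ hQ hQgen ξ' ζ hs.1).add
        ((hasDerivWithinAt_integral_hole hp hρ hQ hQgen ξ ζ hs.1).const_mul (-1)))
    (fun s ζ => by
      have h1 := abs_le.1 (hb s.toNNReal ξ ζ)
      have h2 := abs_le.1 (hb s.toNNReal ξ' ζ)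
      exact abs_le.2 ⟨by linarith, by linarith⟩)
    hβ0 hβC hβ (fun ζ => by
      simp only [Real.toNNReal_zero, hQ.integral_zero _ (measurable_hole ρ J ζ)]
      linarith [h0 ζ]) ζ
  simp only [Real.toNNReal_coe] at h
  linarith

/-- The expected occupation of a site by the dual process started with finitely many particles on
`S` is bounded by a summable function, locally uniformly in time. -/
lemma integral_occ_le (hp : IsSymmetricKernel p)
    (hQ : IsMarkovProcess Q) (hQgen : HasGeneratorOn Q (dualLocalFunctions S B) (dualGen p B))
    {ξ : DualConfig S B} {F : Finset S} (hF : ∀ i ∉ F, ξ.1 i = false) (i : S) (t : ℝ≥0) :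
    ∫ x, occ (x.1 i) ∂(Q t ξ) ≤ Real.exp (3 * t) * potential p (F : Set S) i := by
  have := hQ.markov
  -- with no sinks in the product, the densities are irrelevant
  set ρ : B → ℝ := fun _ => 1 / 2 with hρdef
  have hρ : ∀ i : B, 0 < ρ i ∧ ρ i < 1 := fun i => by norm_num [hρdef]
  have hb : ∀ (t : ℝ≥0) (ξ : DualConfig S B) ζ, |∫ x, hole ρ ∅ ζ x ∂(Q t ξ)| ≤ 1 := fun t ξ ζ =>
    abs_integral_le (abs_hole_le_one hρ ζ)
  have hgen1 : ∀ ζ, holeGen p ρ ∅ (fun _ => (1 : ℝ)) ζ = 0 := fun ζ => by simp [holeGen]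
  have h := holeGen_comparison (ρ := ρ) (J := ∅) hp hρ (T := t) (M := 2) (C := 2)
    (y := fun s ζ => (∫ x, hole ρ ∅ ζ x ∂(Q s.toNNReal ξ)) + (-1) * 1) t.2
    (fun ζ => (continuousOn_integral_hole hρ hQ hQgen ξ ζ _).add continuousOn_const)
    (fun ζ s hs => by
      rw [holeGen_add_mul hp (z := fun _ => 1) (M := 1) (fun _ _ => hb _ _ _)
        (fun _ _ => by norm_num), hgen1, mul_zero, add_zero]
      exact (hasDerivWithinAt_integral_hole hp hρ hQ hQgen ξ ζ hs.1).add_const _)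
    (fun s ζ => by
      have h1 := abs_le.1 (hb s.toNNReal ξ ζ)
      exact abs_le.2 ⟨by linarith, by linarith⟩)
    (potential_nonneg (F : Set S)) (potential_le_two hp F) (tsum_mul_potential_le hp F) (fun ζ => by
      simp only [Real.toNNReal_zero, hQ.integral_zero _ (measurable_hole ρ ∅ ζ)]
      have hw := weight_nonneg (J := (∅ : Finset B)) (potential_nonneg (p := p) (F : Set S))
      have hh := hole_nonneg (J := ∅) hρ ζ ξ
      by_cases hk : ∃ k ∈ ζ, ξ.1 k = true
      · obtain ⟨k, hk, hk1⟩ := hk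
        have hkF : k ∈ (F : Set S) := by
          by_contra hkF
          simp [hF k hkF] at hk1
        have h1 := Finset.single_le_sum
          (fun i _ => potential_nonneg (p := p) (F : Set S) i) hk
        have h2 := one_le_potential hp hkF
        simp only [weight, Finset.sum_empty, add_zero]
        linarith
      · push Not at hk
        have h1 : hole ρ ∅ ζ ξ = 1 := by
          simp only [hole, Finset.prod_empty, mul_one]
          refine Finset.prod_eq_one fun k hk' => ?_
          simp [occ, hk k hk']
        rw [h1]
        linarith [hw ζ]) {i}
  have h1 : ∫ x, hole ρ ∅ {i} x ∂(Q t ξ) = 1 - ∫ x, occ (x.1 i) ∂(Q t ξ) := by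
    have hint : Integrable (fun x : DualConfig S B => occ (x.1 i)) (Q t ξ) :=
      integrable_of_bounded (C := 1)
        (measurable_occ.comp ((measurable_pi_apply i).comp measurable_fst))
        fun x => abs_le.2 ⟨by linarith [occ_nonneg (x.1 i)], occ_le_one _⟩
    simp only [hole, Finset.prod_singleton, Finset.prod_empty, mul_one]
    rw [integral_sub (integrable_const _) hint]
    simp
  simp only [Real.toNNReal_coe, h1, weight, Finset.sum_singleton, Finset.sum_empty, add_zero] at h
  linarith

end Dual

/-! ### Finite-volume duality functions -/

section Cylinder

lemma tendsto_prod_tprod {ι : Type*} {f : ι → ℝ} (h0 : ∀ i, 0 ≤ f i) (h1 : ∀ i, f i ≤ 1) :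
    Tendsto (fun K : Finset ι => ∏ i ∈ K, f i) atTop (𝓝 (∏' i, f i)) := by
  have hanti : Antitone fun K : Finset ι => ∏ i ∈ K, f i := 
    Finset.prod_anti_set_of_le_one h0 h1
  have hbdd : BddBelow (Set.range fun K : Finset ι => ∏ i ∈ K, f i) :=
    ⟨0, by rintro _ ⟨K, rfl⟩; exact Finset.prod_nonneg fun i _ => h0 i⟩
  have h := tendsto_atTop_ciInf hanti hbdd
  have hp : HasProd f (⨅ K : Finset ι, ∏ i ∈ K, f i) := by
    simpa [HasProd] using h
  rwa [hp.tprod_eq]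

variable {S : Type*} {p : S → S → ℝ} {B : Set S} {ρ : B → ℝ}

open Classical in
/-- The duality function with the products restricted to the sites of `K` and to their sinks. It is
local in both arguments. The factor of a site `i` is written so that it is `η(i)` when `ξ(i) = 1`
and `1` otherwise. -/
def cylDuality (ρ : B → ℝ) (K : Finset S) (η : Config S) (ξ : DualConfig S B) : ℝ :=
  (∏ i ∈ K, (1 - occ (ξ.1 i) * (1 - occ (η i)))) * ∏ j ∈ K.subtype (· ∈ B), ρ j ^ ξ.2 j

lemma site_factor_nonneg (a b : Bool) : 0 ≤ 1 - occ a * (1 - occ b) := by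
  cases a <;> cases b <;> simp [occ]

lemma site_factor_le_one (a b : Bool) : 1 - occ a * (1 - occ b) ≤ 1 := by
  cases a <;> cases b <;> simp [occ]

lemma cylDuality_nonneg (hρ : ∀ i, 0 < ρ i ∧ ρ i < 1) (K : Finset S) (η : Config S)
    (ξ : DualConfig S B) : 0 ≤ cylDuality ρ K η ξ :=
  mul_nonneg (Finset.prod_nonneg fun _ _ => site_factor_nonneg _ _) (prod_sink_nonneg hρ _)

lemma cylDuality_le_one (hρ : ∀ i, 0 < ρ i ∧ ρ i < 1) (K : Finset S) (η : Config S)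
    (ξ : DualConfig S B) : cylDuality ρ K η ξ ≤ 1 :=
  mul_le_one₀ (Finset.prod_le_one (fun _ _ => site_factor_nonneg _ _)
    fun _ _ => site_factor_le_one _ _) (prod_sink_nonneg hρ _) (prod_sink_le_one hρ _)

lemma abs_cylDuality_le_one (hρ : ∀ i, 0 < ρ i ∧ ρ i < 1) (K : Finset S) (η : Config S)
    (ξ : DualConfig S B) : |cylDuality ρ K η ξ| ≤ 1 :=
  abs_le.2 ⟨by linarith [cylDuality_nonneg hρ K η ξ], cylDuality_le_one hρ K η ξ⟩

lemma measurable_cylDuality (ρ : B → ℝ) (K : Finset S) :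
    Measurable (Function.uncurry (cylDuality ρ K)) := by
  refine Measurable.mul (Finset.measurable_prod _ fun i _ => ?_)
    (Finset.measurable_prod _ fun j _ => ?_)
  · exact measurable_const.sub ((measurable_occ.comp ((measurable_pi_apply i).comp
      measurable_snd.fst)).mul (measurable_const.sub (measurable_occ.comp
      ((measurable_pi_apply i).comp measurable_fst))))
  · exact measurable_const.pow ((measurable_pi_apply j).comp measurable_snd.snd)

lemma measurable_cylDuality_left (ρ : B → ℝ) (K : Finset S) (ξ : DualConfig S B) :
    Measurable fun η => cylDuality ρ K η ξ :=
  (measurable_cylDuality ρ K).of_uncurry_right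

lemma measurable_cylDuality_right (ρ : B → ℝ) (K : Finset S) (η : Config S) :
    Measurable (cylDuality ρ K η) :=
  (measurable_cylDuality ρ K).of_uncurry_left

lemma measurable_occ_site (i : S) : Measurable fun ξ : DualConfig S B => occ (ξ.1 i) :=
  measurable_occ.comp ((measurable_pi_apply i).comp measurable_fst)

open Classical in
lemma cylDuality_eq_hole (ρ : B → ℝ) (K : Finset S) (η : Config S) (ξ : DualConfig S B) :
    cylDuality ρ K η ξ = hole ρ (K.subtype (· ∈ B)) (K.filter fun i => η i = false) ξ := by
  unfold cylDuality hole
  congr 1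
  rw [Finset.prod_filter]
  refine Finset.prod_congr rfl fun i _ => ?_
  cases η i <;> simp [occ]

open Classical in
lemma cylDuality_eq_prod_occ (ρ : B → ℝ) (K : Finset S) (η : Config S) (ξ : DualConfig S B) :
    cylDuality ρ K η ξ = (∏ j ∈ K.subtype (· ∈ B), ρ j ^ ξ.2 j) *
      ∏ i ∈ K.filter (fun i => ξ.1 i = true), occ (η i) := by
  unfold cylDuality
  rw [mul_comm]
  congr 1
  rw [Finset.prod_filter]
  refine Finset.prod_congr rfl fun i _ => ?_
  cases ξ.1 i <;> simp [occ]

lemma prod_occ_mem_localFunctions (A : Finset S) :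
    (fun η : Config S => ∏ i ∈ A, occ (η i)) ∈ localFunctions S :=
  ⟨A, fun η η' h => Finset.prod_congr rfl fun i hi => by rw [h i hi]⟩

/-! ### The limit of infinite volume -/

lemma dualityFunction_eq (ρ : B → ℝ) (η : Config S) (ξ : DualConfig S B) :
    dualityFunction ρ η ξ =
      (∏' i, (1 - occ (ξ.1 i) * (1 - occ (η i)))) * ∏' j : B, ρ j ^ ξ.2 j := by
  unfold dualityFunction
  congr 1
  refine (tprod_subtype {i | ξ.1 i = true} fun i => occ (η i)).trans (tprod_congr fun i => ?_)
  by_cases h : ξ.1 i = true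
  · rw [Set.mulIndicator_of_mem (by exact h)]; simp [occ, h]
  · rw [Set.mulIndicator_of_notMem (by exact h)]; simp [occ, h]

lemma tendsto_cylDuality (hρ : ∀ i, 0 < ρ i ∧ ρ i < 1) (η : Config S) (ξ : DualConfig S B) :
    Tendsto (fun K => cylDuality ρ K η ξ) atTop (𝓝 (dualityFunction ρ η ξ)) := by
  classical
  rw [dualityFunction_eq]
  unfold cylDuality
  refine (tendsto_prod_tprod (fun _ => site_factor_nonneg _ _)
    fun _ => site_factor_le_one _ _).mul ?_
  have h1 := tendsto_prod_tprod (f := fun j : B => ρ j ^ ξ.2 j)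
    (fun j => pow_nonneg (hρ j).1.le _) fun j => pow_le_one₀ (hρ j).1.le (hρ j).2.le
  have h2 : Tendsto (fun K : Finset S => K.subtype (· ∈ B)) atTop atTop := by
    refine tendsto_atTop_finset_of_monotone (fun K K' h j hj => ?_) fun j => ⟨{(j : S)}, by simp⟩
    rw [Finset.mem_subtype] at hj ⊢
    exact h hj
  exact (h1.comp h2).congr fun K => by simp only [Function.comp]

lemma antitone_cylDuality (hρ : ∀ i, 0 < ρ i ∧ ρ i < 1) (η : Config S) (ξ : DualConfig S B) :
    Antitone fun K => cylDuality ρ K η ξ := by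
  classical
  intro K K' h
  unfold cylDuality
  refine mul_le_mul ?_ ?_ (prod_sink_nonneg hρ _)
    (Finset.prod_nonneg fun _ _ => site_factor_nonneg _ _)
  · exact Finset.prod_anti_set_of_le_one (fun _ => site_factor_nonneg _ _)
      (fun _ => site_factor_le_one _ _) h
  · refine Finset.prod_anti_set_of_le_one (f := fun j : B => ρ j ^ ξ.2 j)
      (fun j => pow_nonneg (hρ j).1.le _) (fun j => pow_le_one₀ (hρ j).1.le (hρ j).2.le) ?_
    intro j hj
    rw [Finset.mem_subtype] at hj ⊢
    exact h hj

lemma dualityFunction_le_cylDuality (hρ : ∀ i, 0 < ρ i ∧ ρ i < 1) (K : Finset S) (η : Config S)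
    (ξ : DualConfig S B) : dualityFunction ρ η ξ ≤ cylDuality ρ K η ξ :=
  (antitone_cylDuality hρ η ξ).le_of_tendsto (tendsto_cylDuality hρ η ξ) K

lemma abs_dualityFunction_le_one (hρ : ∀ i, 0 < ρ i ∧ ρ i < 1) (η : Config S)
    (ξ : DualConfig S B) : |dualityFunction ρ η ξ| ≤ 1 :=
  le_of_tendsto' (tendsto_cylDuality hρ η ξ).abs fun K => abs_cylDuality_le_one hρ K η ξ

open Classical in
/-- The dual configuration `ξ` with all particles on `S` outside `K` removed; the sinks are
unchanged. -/
def truncate (K : Finset S) (ξ : DualConfig S B) : DualConfig S B :=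
  (fun i => if i ∈ K then ξ.1 i else false, ξ.2)

lemma truncate_apply_of_notMem {K : Finset S} (ξ : DualConfig S B) {i : S} (hi : i ∉ K) :
    (truncate K ξ).1 i = false := if_neg hi

lemma tendsto_dualityFunction_truncate (η : Config S) (ξ : DualConfig S B) :
    Tendsto (fun K => dualityFunction ρ η (truncate K ξ)) atTop (𝓝 (dualityFunction ρ η ξ)) := by
  simp only [dualityFunction_eq]
  refine Tendsto.mul ?_ tendsto_const_nhds
  refine (tendsto_prod_tprod (fun i => site_factor_nonneg (ξ.1 i) (η i))
    fun _ => site_factor_le_one _ _).congr fun K => ?_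
  rw [tprod_eq_prod (s := K) fun i hi => by simp [truncate_apply_of_notMem ξ hi, occ]]
  exact Finset.prod_congr rfl fun i hi => by simp [truncate, hi]

lemma hole_le_hole_truncate (hρ : ∀ i, 0 < ρ i ∧ ρ i < 1) (J : Finset B) (K ζ : Finset S)
    (ξ : DualConfig S B) : hole ρ J ζ ξ ≤ hole ρ J ζ (truncate K ξ) := by
  refine mul_le_mul_of_nonneg_right (Finset.prod_le_prod (fun i _ => sub_nonneg.2 (occ_le_one _))
    fun i _ => ?_) (prod_sink_nonneg hρ _)
  by_cases hi : i ∈ K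
  · simp [truncate, hi]
  · simp [truncate, hi, occ]
    split_ifs <;> simp

section Countable

variable [Countable S]

lemma measurable_dualityFunction (hρ : ∀ i, 0 < ρ i ∧ ρ i < 1) :
    Measurable (Function.uncurry (dualityFunction ρ)) :=
  measurable_of_tendsto_metrizable' atTop (fun K : Finset S => measurable_cylDuality ρ K)
    (tendsto_pi_nhds.2 fun z => tendsto_cylDuality hρ z.1 z.2)

lemma measurable_dualityFunction_left (hρ : ∀ i, 0 < ρ i ∧ ρ i < 1) (ξ : DualConfig S B) :
    Measurable fun η => dualityFunction ρ η ξ :=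
  (measurable_dualityFunction hρ).of_uncurry_right

lemma measurable_dualityFunction_right (hρ : ∀ i, 0 < ρ i ∧ ρ i < 1) (η : Config S) :
    Measurable (dualityFunction ρ η) :=
  (measurable_dualityFunction hρ).of_uncurry_left

lemma tendsto_integral_cylDuality_left (hρ : ∀ i, 0 < ρ i ∧ ρ i < 1) (μ : Measure (Config S))
    [IsProbabilityMeasure μ] (ξ : DualConfig S B) :
    Tendsto (fun K => ∫ η, cylDuality ρ K η ξ ∂μ) atTop (𝓝 (∫ η, dualityFunction ρ η ξ ∂μ)) :=
  tendsto_integral_filter_of_norm_le_const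
    (Eventually.of_forall fun K => (measurable_cylDuality_left ρ K ξ).aestronglyMeasurable)
    ⟨1, Eventually.of_forall fun K => ae_of_all _ fun η => abs_cylDuality_le_one hρ K η ξ⟩
    (ae_of_all _ fun η => tendsto_cylDuality hρ η ξ)

lemma tendsto_integral_cylDuality_right (hρ : ∀ i, 0 < ρ i ∧ ρ i < 1)
    (μ : Measure (DualConfig S B)) [IsProbabilityMeasure μ] (η : Config S) :
    Tendsto (fun K => ∫ ξ, cylDuality ρ K η ξ ∂μ) atTop (𝓝 (∫ ξ, dualityFunction ρ η ξ ∂μ)) :=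
  tendsto_integral_filter_of_norm_le_const
    (Eventually.of_forall fun K => (measurable_cylDuality_right ρ K η).aestronglyMeasurable)
    ⟨1, Eventually.of_forall fun K => ae_of_all _ fun ξ => abs_cylDuality_le_one hρ K η ξ⟩
    (ae_of_all _ fun ξ => tendsto_cylDuality hρ η ξ)

end Countable

end Cylinder

/-! ### Approximate duality of the generators -/

section Generators

variable {S : Type*} {p : S → S → ℝ} {B : Set S} {ρ : B → ℝ}

lemma summable_mul_add (hp : IsSymmetricKernel p) {β : S → ℝ} (hβ0 : ∀ i, 0 ≤ β i)
    (hβ : Summable β) : Summable fun x : S × S => p x.1 x.2 / 2 * (β x.1 + β x.2) := by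
  have h1 : Summable fun x : S × S => p x.1 x.2 * β x.1 := by
    have h0 : 0 ≤ fun x : S × S => p x.1 x.2 * β x.1 := fun x =>
      mul_nonneg (hp.nonneg x.1 x.2) (hβ0 x.1)
    have h3 : ∀ i, ∑' l, p i l * β i = β i := fun i => by
      rw [tsum_mul_right, (hp.hasSum i).tsum_eq, one_mul]
    rw [summable_prod_of_nonneg h0]
    refine ⟨fun i => (hp.hasSum i).summable.mul_right (β i), ?_⟩
    simpa only [h3] using hβ
  have h2 : Summable fun x : S × S => p x.1 x.2 * β x.2 := by
    refine ((Equiv.prodComm S S).summable_iff.2 h1).congr fun x => ?_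
    simp [hp.symm x.1 x.2]
  refine ((h1.add h2).div_const 2).congr fun x => ?_
  ring

variable [DecidableEq S]

lemma gen_const_mul (c : ℝ) (f : Config S → ℝ) (η : Config S) :
    gen p B ρ (fun η => c * f η) η = c * gen p B ρ f η := by
  unfold gen
  rw [mul_add, ← tsum_mul_left, ← tsum_mul_left]
  congr 1
  · exact tsum_congr fun x => by ring
  · exact tsum_congr fun i => by ring

/-- Half the rates of the exchanges between `K` and its complement. -/
def crossRate (p : S → S → ℝ) (K : Finset S) (x : S × S) : ℝ :=
  if x.1 ∈ K ↔ x.2 ∈ K then 0 else p x.1 x.2 / 2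

/-- The total rate of those exchanges between `K` and its complement that involve a particle of
`ξ`. -/
def crossing (p : S → S → ℝ) (K : Finset S) (ξ : DualConfig S B) : ℝ :=
  ∑' x : S × S, crossRate p K x * (occ (ξ.1 x.1) + occ (ξ.1 x.2))

lemma crossRate_nonneg (hp : IsSymmetricKernel p) (K : Finset S) (x : S × S) :
    0 ≤ crossRate p K x := by
  unfold crossRate; split_ifs
  · exact le_rfl
  · exact div_nonneg (hp.nonneg _ _) zero_le_two

lemma crossRate_le (hp : IsSymmetricKernel p) (K : Finset S) (x : S × S) :
    crossRate p K x ≤ p x.1 x.2 / 2 := by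
  unfold crossRate; split_ifs
  · exact div_nonneg (hp.nonneg _ _) zero_le_two
  · exact le_rfl

lemma summable_crossRate (hp : IsSymmetricKernel p) (K : Finset S) : Summable (crossRate p K) := by
  refine summable_of_touch hp (K := K) (C := 1) (fun x => ?_) fun x h1 h2 => by
    simp [crossRate, h1, h2]
  rw [abs_of_nonneg (crossRate_nonneg hp K x)]
  linarith [crossRate_le hp K x, hp.nonneg x.1 x.2]

lemma abs_occ_add_occ_le (a b : Bool) : |occ a + occ b| ≤ 2 := by
  cases a <;> cases b <;> norm_num [occ]

lemma summable_crossing (hp : IsSymmetricKernel p) (K : Finset S) (ξ : DualConfig S B) :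
    Summable fun x : S × S => crossRate p K x * (occ (ξ.1 x.1) + occ (ξ.1 x.2)) := by
  refine Summable.of_norm_bounded ((summable_crossRate hp K).mul_right 2) fun x => ?_
  rw [norm_mul, Real.norm_of_nonneg (crossRate_nonneg hp K x)]
  exact mul_le_mul_of_nonneg_left (abs_occ_add_occ_le _ _) (crossRate_nonneg hp K x)

/-- An exchange within `K` or within its complement has the same effect on `cylDuality` in either
argument; so has an exchange that involves no particle of `ξ`. -/
lemma abs_cylDuality_swap_sub_le (hp : IsSymmetricKernel p) (hρ : ∀ i, 0 < ρ i ∧ ρ i < 1)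
    (K : Finset S) (η : Config S) (ξ : DualConfig S B) (x : S × S) :
    |p x.1 x.2 / 2 * (cylDuality ρ K (η ∘ Equiv.swap x.1 x.2) ξ - cylDuality ρ K η ξ) -
        p x.1 x.2 / 2 *
          (cylDuality ρ K η (ξ.1 ∘ Equiv.swap x.1 x.2, ξ.2) - cylDuality ρ K η ξ)| ≤
      crossRate p K x * (occ (ξ.1 x.1) + occ (ξ.1 x.2)) := by
  have hpx := div_nonneg (hp.nonneg x.1 x.2) zero_le_two
  rw [← mul_sub, sub_sub_sub_cancel_right, abs_mul, abs_of_nonneg hpx]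
  have hr : 0 ≤ crossRate p K x * (occ (ξ.1 x.1) + occ (ξ.1 x.2)) :=
    mul_nonneg (crossRate_nonneg hp K x) (add_nonneg (occ_nonneg _) (occ_nonneg _))
  set σ := Equiv.swap x.1 x.2 with hσ
  by_cases hK : x.1 ∈ K ↔ x.2 ∈ K
  · have hmem : ∀ i, i ∈ K ↔ σ i ∈ K := by
      intro i
      by_cases h1 : i = x.1
      · rw [h1, hσ, Equiv.swap_apply_left]; exact hK
      by_cases h2 : i = x.2
      · rw [h2, hσ, Equiv.swap_apply_right]; exact hK.symm
      rw [hσ, Equiv.swap_apply_of_ne_of_ne h1 h2]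
    have : cylDuality ρ K (η ∘ σ) ξ = cylDuality ρ K η (ξ.1 ∘ σ, ξ.2) := by
      unfold cylDuality
      congr 1
      refine Finset.prod_equiv σ hmem fun i _ => ?_
      simp only [Function.comp]
      rw [hσ, Equiv.swap_apply_self]
    rw [this, sub_self, abs_zero, mul_zero]
    exact hr
  by_cases hξ : ξ.1 x.1 = false ∧ ξ.1 x.2 = false
  · have : cylDuality ρ K (η ∘ σ) ξ = cylDuality ρ K η (ξ.1 ∘ σ, ξ.2) := by
      rw [comp_swap_of_eq (hξ.1.trans hξ.2.symm)]
      unfold cylDuality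
      congr 1
      refine Finset.prod_congr rfl fun i _ => ?_
      by_cases h1 : i = x.1
      · simp [h1, hξ.1, occ]
      by_cases h2 : i = x.2
      · simp [h2, hξ.2, occ]
      simp only [Function.comp]
      rw [hσ, Equiv.swap_apply_of_ne_of_ne h1 h2]
    rw [this, sub_self, abs_zero, mul_zero]
    exact hr
  · have h1 : |cylDuality ρ K (η ∘ σ) ξ - cylDuality ρ K η (ξ.1 ∘ σ, ξ.2)| ≤ 1 := by
      have h1 := cylDuality_nonneg hρ K (η ∘ σ) ξ
      have h2 := cylDuality_le_one hρ K (η ∘ σ) ξ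
      have h3 := cylDuality_nonneg hρ K η (ξ.1 ∘ σ, ξ.2)
      have h4 := cylDuality_le_one hρ K η (ξ.1 ∘ σ, ξ.2)
      exact abs_le.2 ⟨by linarith, by linarith⟩
    have h2 : 1 ≤ occ (ξ.1 x.1) + occ (ξ.1 x.2) := by
      rcases ha : ξ.1 x.1 with _ | _ <;> rcases hb : ξ.1 x.2 with _ | _
      · exact absurd ⟨ha, hb⟩ hξ
      all_goals simp [occ]
    rw [crossRate, if_neg hK]
    exact mul_le_mul_of_nonneg_left (h1.trans h2) hpx

/-- The action of a reservoir on `cylDuality` in the first argument is the absorption of particles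
in the second. -/
lemma reservoir_cylDuality (ρ : B → ℝ) (K : Finset S) (η : Config S) (ξ : DualConfig S B) (i : B) :
    (1 - ρ i) * occ (η i) * (cylDuality ρ K (flipAt η i) ξ - cylDuality ρ K η ξ) +
        ρ i * (1 - occ (η i)) * (cylDuality ρ K (flipAt η i) ξ - cylDuality ρ K η ξ) =
      occ (ξ.1 i) * (cylDuality ρ K η (absorb ξ i) - cylDuality ρ K η ξ) := by
  classical
  simp only [cylDuality_eq_hole]
  rw [occ_mul_hole_absorb_sub]
  set Z : Finset S := K.filter fun k => η k = false with hZ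
  by_cases hi : (i : S) ∈ K
  · have hf : fillRate ρ (K.subtype (· ∈ B)) i = ρ i := if_pos (by simpa using hi)
    rw [hf]
    rcases hη : η i with _ | _
    · have h1 : (K.filter fun k => flipAt η i k = false) = Z.erase i := by
        ext k
        by_cases hk : k = i
        · subst hk; simp [flipAt, hη, hZ]
        · simp only [hZ, Finset.mem_filter, Finset.mem_erase]
          simp [flipAt, hk]
      have h2 : insert (i : S) Z = Z := Finset.insert_eq_of_mem (by simp [hZ, hi, hη])
      rw [h1, h2]
      simp [occ]
    · have h1 : (K.filter fun k => flipAt η i k = false) = insert (i : S) Z := by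
        ext k
        by_cases hk : k = i
        · subst hk; simp [flipAt, hη, hi]
        · simp only [hZ, Finset.mem_filter, Finset.mem_insert]
          simp [flipAt, hk]
      have h2 : Z.erase i = Z := Finset.erase_eq_of_notMem (by simp [hZ, hη])
      rw [h1, h2]
      simp [occ]
  · have hf : fillRate ρ (K.subtype (· ∈ B)) i = 1 := if_neg (by simpa using hi)
    have h1 : (K.filter fun k => flipAt η i k = false) = Z := by
      refine Finset.filter_congr fun k hk => ?_
      have : k ≠ i := fun h => hi (h ▸ hk)
      simp [flipAt, this]
    have h2 : Z.erase i = Z := Finset.erase_eq_of_notMem (by simp [hZ, hi])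
    rw [hf, h1, h2]
    simp

/-- Duality of the generators on finite-volume duality functions, up to the exchanges across the
boundary of the volume. -/
lemma abs_gen_sub_dualGen_le (hp : IsSymmetricKernel p) (hρ : ∀ i, 0 < ρ i ∧ ρ i < 1)
    (K : Finset S) (η : Config S) (ξ : DualConfig S B) :
    |gen p B ρ (fun η' => cylDuality ρ K η' ξ) η - dualGen p B (cylDuality ρ K η) ξ| ≤
      crossing p K ξ := by
  have hloc1 : ∀ η η' : Config S, (∀ i ∈ K, η i = η' i) →
      cylDuality ρ K η ξ = cylDuality ρ K η' ξ := fun η η' h => by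
    unfold cylDuality
    congr 1
    exact Finset.prod_congr rfl fun i hi => by rw [h i hi]
  have hloc2 : ∀ η₁ η₂ : Config S, (∀ i ∈ K, η₁ i = η₂ i) →
      cylDuality ρ K η (η₁, ξ.2) = cylDuality ρ K η (η₂, ξ.2) := fun η₁ η₂ h => by
    unfold cylDuality
    congr 1
    exact Finset.prod_congr rfl fun i hi => by simp only [h i hi]
  have hb1 : ∀ η : Config S, |cylDuality ρ K η ξ| ≤ 1 := fun η => abs_cylDuality_le_one hρ K η ξ
  have hb2 : ∀ η' : Config S, |cylDuality ρ K η (η', ξ.2)| ≤ 1 := fun η' =>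
    abs_cylDuality_le_one hρ K η _
  have e1 := tsum_exclusion_eq_stirring hp (g := fun η => cylDuality ρ K η ξ) hloc1 hb1 η
  have e2 := tsum_exclusion_eq_stirring hp (g := fun η' => cylDuality ρ K η (η', ξ.2)) hloc2 hb2 ξ.1
  have s1 := summable_stirring hp (g := fun η => cylDuality ρ K η ξ) hloc1 hb1 η
  have s2 := summable_stirring hp (g := fun η' => cylDuality ρ K η (η', ξ.2)) hloc2 hb2 ξ.1
  have e3 : gen p B ρ (fun η' => cylDuality ρ K η' ξ) η - dualGen p B (cylDuality ρ K η) ξ =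
      ∑' x : S × S, (p x.1 x.2 / 2 *
        (cylDuality ρ K (η ∘ Equiv.swap x.1 x.2) ξ - cylDuality ρ K η ξ) - p x.1 x.2 / 2 *
          (cylDuality ρ K η (ξ.1 ∘ Equiv.swap x.1 x.2, ξ.2) - cylDuality ρ K η ξ)) := by
    rw [s1.tsum_sub s2]
    unfold gen dualGen
    rw [tsum_congr (reservoir_cylDuality ρ K η ξ), add_sub_add_right_eq_sub]
    exact congrArg₂ _ e1 e2
  rw [e3, ← Real.norm_eq_abs]
  exact tsum_of_norm_bounded (summable_crossing hp K ξ).hasSum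
    fun x => abs_cylDuality_swap_sub_le hp hρ K η ξ x

variable {P : ℝ≥0 → Kernel (Config S) (Config S)}
  {Q : ℝ≥0 → Kernel (DualConfig S B) (DualConfig S B)}

/-- Uniformity holds because, up to a factor in `[0, 1]`, only finitely many functions occur. -/
lemma eventually_expectation_sub_le (hp : IsSymmetricKernel p) (hρ : ∀ i, 0 < ρ i ∧ ρ i < 1)
    (hPgen : HasGeneratorOn P (localFunctions S) (gen p B ρ))
    (hQgen : HasGeneratorOn Q (dualLocalFunctions S B) (dualGen p B)) (K : Finset S) {ε : ℝ}
    (hε : 0 < ε) :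
    ∀ᶠ h : ℝ≥0 in 𝓝[>] 0, ∀ η ξ,
      |(∫ η', cylDuality ρ K η' ξ ∂(P h η)) - ∫ ξ', cylDuality ρ K η ξ' ∂(Q h ξ)| ≤
        h * (crossing p K ξ + ε) := by
  classical
  have hPev : ∀ᶠ h : ℝ≥0 in 𝓝[>] 0, ∀ A ∈ K.powerset, ∀ η : Config S,
      |(∫ η' : Config S, ∏ i ∈ A, occ (η' i) ∂(P h η)) - ∏ i ∈ A, occ (η i) -
        h * gen p B ρ (fun η => ∏ i ∈ A, occ (η i)) η| ≤ h * (ε / 2) :=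
    (eventually_all_finset _).2 fun A _ =>
      eventually_sub_le_of_generator (hPgen _ (prod_occ_mem_localFunctions A)) (half_pos hε)
  have hQev : ∀ᶠ h : ℝ≥0 in 𝓝[>] 0, ∀ A ∈ K.powerset, ∀ ξ : DualConfig S B,
      |(∫ ξ', hole ρ (K.subtype (· ∈ B)) A ξ' ∂(Q h ξ)) - hole ρ (K.subtype (· ∈ B)) A ξ -
        h * dualGen p B (hole ρ (K.subtype (· ∈ B)) A) ξ| ≤ h * (ε / 2) :=
    (eventually_all_finset _).2 fun A _ =>
      eventually_sub_le_of_generator (hQgen _ (hole_mem_dualLocalFunctions hρ A)) (half_pos hε)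
  filter_upwards [hPev, hQev] with h h1 h2 η ξ
  have hh : (0 : ℝ) ≤ h := h.2
  have k1 : |(∫ η', cylDuality ρ K η' ξ ∂(P h η)) - cylDuality ρ K η ξ -
      h * gen p B ρ (fun η' => cylDuality ρ K η' ξ) η| ≤ h * (ε / 2) := by
    have h3 := h1 (K.filter fun i => ξ.1 i = true)
      (Finset.mem_powerset.2 (Finset.filter_subset _ _)) η
    have hR0 := prod_sink_nonneg (J := K.subtype (· ∈ B)) hρ ξ.2
    have hR1 := prod_sink_le_one (J := K.subtype (· ∈ B)) hρ ξ.2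
    simp only [cylDuality_eq_prod_occ]
    rw [integral_const_mul, gen_const_mul, mul_left_comm, ← mul_sub, ← mul_sub, abs_mul,
      abs_of_nonneg hR0]
    exact (mul_le_of_le_one_left (abs_nonneg _) hR1).trans h3
  have k2 : |(∫ ξ', cylDuality ρ K η ξ' ∂(Q h ξ)) - cylDuality ρ K η ξ -
      h * dualGen p B (cylDuality ρ K η) ξ| ≤ h * (ε / 2) := by
    have h3 := h2 (K.filter fun i => η i = false)
      (Finset.mem_powerset.2 (Finset.filter_subset _ _)) ξ
    have e : cylDuality ρ K η = hole ρ (K.subtype (· ∈ B)) (K.filter fun i => η i = false) :=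
      funext fun ξ => by rw [cylDuality_eq_hole]
    rw [e]
    exact h3
  have k3 := mul_le_mul_of_nonneg_left (abs_gen_sub_dualGen_le hp hρ K η ξ) hh
  rw [← abs_of_nonneg hh, ← abs_mul, abs_of_nonneg hh] at k3
  rw [abs_le] at *
  constructor <;> nlinarith

/-! ### Duality for finitely many dual particles -/

lemma tendsto_tsum_crossRate (hp : IsSymmetricKernel p) {β : S → ℝ} (hβ0 : ∀ i, 0 ≤ β i)
    (hβ : Summable β) :
    Tendsto (fun K : Finset S => ∑' x : S × S, crossRate p K x * (β x.1 + β x.2)) atTop (𝓝 0) := by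
  have h := tendsto_tsum_of_dominated_convergence (𝓕 := (atTop : Filter (Finset S)))
    (f := fun K (x : S × S) => crossRate p K x * (β x.1 + β x.2)) (g := fun _ => 0)
    (summable_mul_add hp hβ0 hβ) (fun x => ?_) (Eventually.of_forall fun K x => ?_)
  · simpa using h
  · refine tendsto_const_nhds.congr' ?_
    filter_upwards [eventually_ge_atTop ({x.1, x.2} : Finset S)] with K hK
    have h1 : x.1 ∈ K := hK (by simp)
    have h2 : x.2 ∈ K := hK (by simp)
    simp [crossRate, h1, h2]
  · rw [norm_mul, Real.norm_of_nonneg (crossRate_nonneg hp K x),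
      Real.norm_of_nonneg (add_nonneg (hβ0 _) (hβ0 _))]
    exact mul_le_mul_of_nonneg_right (crossRate_le hp K x) (add_nonneg (hβ0 _) (hβ0 _))

lemma hole_truncate_le (hp : IsSymmetricKernel p) (hρ : ∀ i, 0 < ρ i ∧ ρ i < 1) (J : Finset B)
    (K ζ : Finset S) (ξ : DualConfig S B) :
    hole ρ J ζ (truncate K ξ) ≤ hole ρ J ζ ξ + weight (potential p ((K : Set S)ᶜ)) J ζ := by
  have hw := potential_nonneg (p := p) ((K : Set S)ᶜ)
  by_cases hζ : ζ ⊆ K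
  · have : hole ρ J ζ (truncate K ξ) = hole ρ J ζ ξ := by
      unfold hole
      congr 1
      exact Finset.prod_congr rfl fun i hi => by simp [truncate, hζ hi]
    rw [this]
    exact le_add_of_nonneg_right (weight_nonneg hw ζ)
  · obtain ⟨k, hk, hkK⟩ := Finset.not_subset.1 hζ
    have h1 := Finset.single_le_sum (fun i _ => hw i) hk
    have h2 : 1 ≤ potential p ((K : Set S)ᶜ) k := one_le_potential hp (by simpa using hkK)
    have h3 : 0 ≤ ∑ j ∈ J, potential p ((K : Set S)ᶜ) j := Finset.sum_nonneg fun j _ => hw j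
    have h4 := hole_le_one (J := J) hρ ζ (truncate K ξ)
    have h5 := hole_nonneg (J := J) hρ ζ ξ
    unfold weight
    linarith

variable [Countable S]

lemma integrable_crossing (hp : IsSymmetricKernel p) (K : Finset S)
    (μ : Measure (DualConfig S B)) [IsProbabilityMeasure μ] : Integrable (crossing p K) μ :=
  integrable_tsum_mul (g := fun (x : S × S) (ξ : DualConfig S B) =>
      occ (ξ.1 x.1) + occ (ξ.1 x.2)) (summable_crossRate hp K) (crossRate_nonneg hp K)
    (fun x => (measurable_occ_site x.1).add (measurable_occ_site x.2))
    (fun _ _ => abs_occ_add_occ_le _ _)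

lemma integral_crossing_le (hp : IsSymmetricKernel p) (hQ : IsMarkovProcess Q)
    (hQgen : HasGeneratorOn Q (dualLocalFunctions S B) (dualGen p B))
    {ξ : DualConfig S B} {F : Finset S} (hF : ∀ i ∉ F, ξ.1 i = false) (K : Finset S) {s t : ℝ≥0}
    (hst : s ≤ t) :
    ∫ ξ', crossing p K ξ' ∂(Q s ξ) ≤ Real.exp (3 * t) *
      ∑' x : S × S, crossRate p K x *
        (potential p (F : Set S) x.1 + potential p (F : Set S) x.2) := by
  have := hQ.markov
  have hint : ∀ i, Integrable (fun ξ : DualConfig S B => occ (ξ.1 i)) (Q s ξ) := fun i =>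
    integrable_of_bounded (C := 1) (measurable_occ_site i)
      fun x => abs_le.2 ⟨by linarith [occ_nonneg (x.1 i)], occ_le_one _⟩
  have hocc : ∀ i, ∫ x, occ (x.1 i) ∂(Q s ξ) ≤ Real.exp (3 * t) * potential p (F : Set S) i :=
    fun i => (integral_occ_le hp hQ hQgen hF i s).trans (mul_le_mul_of_nonneg_right
      (Real.exp_le_exp.2 (mul_le_mul_of_nonneg_left (NNReal.coe_le_coe.2 hst) (by norm_num)))
      (potential_nonneg _ _))
  have hs : Summable fun x : S × S => crossRate p K x *
      (potential p (F : Set S) x.1 + potential p (F : Set S) x.2) :=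
    Summable.of_nonneg_of_le (fun x => mul_nonneg (crossRate_nonneg hp K x)
      (add_nonneg (potential_nonneg _ _) (potential_nonneg _ _)))
      (fun x => mul_le_mul_of_nonneg_right (crossRate_le hp K x)
        (add_nonneg (potential_nonneg _ _) (potential_nonneg _ _)))
      (summable_mul_add hp (potential_nonneg _) (summable_potential hp F))
  have hle : ∀ x : S × S, crossRate p K x * ∫ ξ', (occ (ξ'.1 x.1) + occ (ξ'.1 x.2)) ∂(Q s ξ) ≤
      Real.exp (3 * t) * (crossRate p K x *
        (potential p (F : Set S) x.1 + potential p (F : Set S) x.2)) := fun x => by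
    rw [integral_add (hint _) (hint _), mul_left_comm, mul_add (Real.exp _)]
    exact mul_le_mul_of_nonneg_left (add_le_add (hocc _) (hocc _)) (crossRate_nonneg hp K x)
  unfold crossing
  rw [integral_tsum_mul (g := fun (x : S × S) (ξ' : DualConfig S B) =>
      occ (ξ'.1 x.1) + occ (ξ'.1 x.2)) (summable_crossRate hp K) (crossRate_nonneg hp K)
    (fun x => (measurable_occ_site x.1).add (measurable_occ_site x.2))
    (fun _ _ => abs_occ_add_occ_le _ _), ← tsum_mul_left]
  refine Summable.tsum_le_tsum hle (Summable.of_nonneg_of_le (fun x => ?_) hle (hs.mul_left _))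
    (hs.mul_left _)
  exact mul_nonneg (crossRate_nonneg hp K x)
    (integral_nonneg fun _ => add_nonneg (occ_nonneg _) (occ_nonneg _))

/-- Duality when the dual process starts with finitely many particles on `S`. The expected number
of particles then stays finite, so the rate of exchanges across the boundary of `K` tends to zero
as `K` increases. -/
lemma integral_dualityFunction_eq_of_finite (hp : IsSymmetricKernel p)
    (hρ : ∀ i, 0 < ρ i ∧ ρ i < 1) (hP : IsMarkovProcess P)
    (hPgen : HasGeneratorOn P (localFunctions S) (gen p B ρ)) (hQ : IsMarkovProcess Q)
    (hQgen : HasGeneratorOn Q (dualLocalFunctions S B) (dualGen p B)) (t : ℝ≥0) (η : Config S)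
    {ξ : DualConfig S B} {F : Finset S} (hF : ∀ i ∉ F, ξ.1 i = false) :
    ∫ η', dualityFunction ρ η' ξ ∂(P t η) = ∫ ξ', dualityFunction ρ η ξ' ∂(Q t ξ) := by
  have := hP.markov
  have := hQ.markov
  have h1 := fun K => abs_sub_le_of_approx_duality hP hQ (measurable_cylDuality ρ K)
    (abs_cylDuality_le_one hρ K)
    (fun ε hε => eventually_expectation_sub_le hp hρ hPgen hQgen K hε) (t := t) (y := ξ)
    (fun s _ => integrable_crossing hp K (Q s ξ))
    (fun s hs => integral_crossing_le hp hQ hQgen hF K hs) η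
  have h2 := ((tendsto_integral_cylDuality_left hρ (P t η) ξ).sub
    (tendsto_integral_cylDuality_right hρ (Q t ξ) η)).abs
  have h3 := ((tendsto_tsum_crossRate hp (potential_nonneg (F : Set S))
    (summable_potential hp F)).const_mul (Real.exp (3 * t))).const_mul (t : ℝ)
  rw [mul_zero, mul_zero] at h3
  exact sub_eq_zero.1 (abs_nonpos_iff.1 (le_of_tendsto_of_tendsto' h2 h3 h1))

/-! ### Infinitely many dual particles -/

/-- Removing particles from the initial state increases the expectation of `cylDuality`. -/
lemma integral_cylDuality_le_truncate (hp : IsSymmetricKernel p) (hρ : ∀ i, 0 < ρ i ∧ ρ i < 1)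
    (hQ : IsMarkovProcess Q) (hQgen : HasGeneratorOn Q (dualLocalFunctions S B) (dualGen p B))
    (t : ℝ≥0) (η : Config S) (ξ : DualConfig S B) (K L : Finset S) :
    ∫ ξ', cylDuality ρ L η ξ' ∂(Q t ξ) ≤ ∫ ξ', cylDuality ρ L η ξ' ∂(Q t (truncate K ξ)) := by
  classical
  simp only [cylDuality_eq_hole]
  have h := integral_hole_sub_le (J := L.subtype (· ∈ B)) hp hρ hQ hQgen (ξ := ξ)
    (ξ' := truncate K ξ) (β := fun _ => 0) (C := 0) (fun _ => le_rfl) (fun _ => le_rfl)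
    (fun _ => by simp) (fun ζ => by
      simpa [weight] using hole_le_hole_truncate hρ (L.subtype (· ∈ B)) K ζ ξ)
    (L.filter fun i => η i = false) t
  simpa [weight] using h

lemma exists_integral_cylDuality_truncate_le (hp : IsSymmetricKernel p)
    (hρ : ∀ i, 0 < ρ i ∧ ρ i < 1) (hQ : IsMarkovProcess Q)
    (hQgen : HasGeneratorOn Q (dualLocalFunctions S B) (dualGen p B))
    (t : ℝ≥0) (η : Config S) (ξ : DualConfig S B) (L : Finset S) :
    ∃ δ : Finset S → ℝ, Tendsto δ atTop (𝓝 0) ∧ ∀ K,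
      ∫ ξ', cylDuality ρ L η ξ' ∂(Q t (truncate K ξ)) ≤
        ∫ ξ', cylDuality ρ L η ξ' ∂(Q t ξ) + δ K := by
  classical
  refine ⟨fun K => Real.exp (3 * t) * weight (potential p ((K : Set S)ᶜ)) (L.subtype (· ∈ B))
    (L.filter fun i => η i = false), ?_, fun K => ?_⟩
  · have h1 := (tendsto_finsetSum (L.filter fun i => η i = false) fun i _ =>
      tendsto_potential_compl hp i).add
      (tendsto_finsetSum (L.subtype (· ∈ B)) fun j _ => tendsto_potential_compl hp (j : S))
    simpa [weight] using h1.const_mul (Real.exp (3 * t))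
  · simp only [cylDuality_eq_hole]
    exact integral_hole_sub_le hp hρ hQ hQgen (potential_nonneg _) (potential_le_two hp _)
      (tsum_mul_potential_le hp _) (fun ζ => hole_truncate_le hp hρ _ K ζ ξ) _ t

lemma integral_dualityFunction_eq (hp : IsSymmetricKernel p)
    (hρ : ∀ i, 0 < ρ i ∧ ρ i < 1) (hP : IsMarkovProcess P)
    (hPgen : HasGeneratorOn P (localFunctions S) (gen p B ρ)) (hQ : IsMarkovProcess Q)
    (hQgen : HasGeneratorOn Q (dualLocalFunctions S B) (dualGen p B)) (t : ℝ≥0) (η : Config S)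
    (ξ : DualConfig S B) :
    ∫ η', dualityFunction ρ η' ξ ∂(P t η) = ∫ ξ', dualityFunction ρ η ξ' ∂(Q t ξ) := by
  have := hP.markov
  have := hQ.markov
  have hfin : ∀ K, ∫ η', dualityFunction ρ η' (truncate K ξ) ∂(P t η) =
      ∫ ξ', dualityFunction ρ η ξ' ∂(Q t (truncate K ξ)) := fun K =>
    integral_dualityFunction_eq_of_finite hp hρ hP hPgen hQ hQgen t η
      fun i hi => truncate_apply_of_notMem ξ hi
  have hlim : Tendsto (fun K => ∫ ξ', dualityFunction ρ η ξ' ∂(Q t (truncate K ξ))) atTop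
      (𝓝 (∫ η', dualityFunction ρ η' ξ ∂(P t η))) := by
    simp only [← hfin]
    exact tendsto_integral_filter_of_norm_le_const
      (Eventually.of_forall fun K =>
        (measurable_dualityFunction_left hρ (truncate K ξ)).aestronglyMeasurable)
      ⟨1, Eventually.of_forall fun K => ae_of_all _ fun η => abs_dualityFunction_le_one hρ η _⟩
      (ae_of_all _ fun η => tendsto_dualityFunction_truncate η ξ)
  refine le_antisymm ?_ ?_
  · refine ge_of_tendsto' (tendsto_integral_cylDuality_right hρ (Q t ξ) η) fun L => ?_
    obtain ⟨δ, hδ, hle⟩ := exists_integral_cylDuality_truncate_le hp hρ hQ hQgen t η ξ L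
    have hδ' := hδ.const_add (∫ ξ', cylDuality ρ L η ξ' ∂(Q t ξ))
    rw [add_zero] at hδ'
    refine le_of_tendsto_of_tendsto' hlim hδ' fun K => le_trans ?_ (hle K)
    exact integral_mono
      (integrable_of_bounded (measurable_dualityFunction_right hρ η)
        (abs_dualityFunction_le_one hρ η))
      (integrable_of_bounded (measurable_cylDuality_right ρ L η) (abs_cylDuality_le_one hρ L η))
      fun ξ' => dualityFunction_le_cylDuality hρ L η ξ'
  · refine ge_of_tendsto' hlim fun K => ?_
    exact le_of_tendsto_of_tendsto' (tendsto_integral_cylDuality_right hρ (Q t ξ) η)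
      (tendsto_integral_cylDuality_right hρ (Q t (truncate K ξ)) η)
      fun L => integral_cylDuality_le_truncate hp hρ hQ hQgen t η ξ K L

end Generators

end BoundaryExclusion

end

theorem theorem4p3 {S : Type*} [Countable S] [DecidableEq S]
    (p : S → S → ℝ) (hp : BoundaryExclusion.IsSymmetricKernel p)
    (B : Set S) (ρ : B → ℝ) (hρ : ∀ i, 0 < ρ i ∧ ρ i < 1)
    (P : ℝ≥0 → Kernel (BoundaryExclusion.Config S) (BoundaryExclusion.Config S))
    (hP : BoundaryExclusion.IsMarkovProcess P)
    (hPgen : BoundaryExclusion.HasGeneratorOn P (BoundaryExclusion.localFunctions S)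
      (BoundaryExclusion.gen p B ρ))
    (Q : ℝ≥0 → Kernel (BoundaryExclusion.DualConfig S B) (BoundaryExclusion.DualConfig S B))
    (hQ : BoundaryExclusion.IsMarkovProcess Q)
    (hQgen : BoundaryExclusion.HasGeneratorOn Q (BoundaryExclusion.dualLocalFunctions S B)
      (BoundaryExclusion.dualGen p B)) :
    BoundaryExclusion.IsDual P Q (BoundaryExclusion.dualityFunction ρ) := by
  have := hP.markov
  have := hQ.markov
  intro t η ξ
  refine ⟨?_, ?_, ?_⟩
  · exact BoundaryExclusion.integrable_of_bounded
      (BoundaryExclusion.measurable_dualityFunction_left hρ ξ)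
      fun η' => BoundaryExclusion.abs_dualityFunction_le_one hρ η' ξ
  · exact BoundaryExclusion.integrable_of_bounded
      (BoundaryExclusion.measurable_dualityFunction_right hρ η)
      fun ξ' => BoundaryExclusion.abs_dualityFunction_le_one hρ η ξ'
  · exact BoundaryExclusion.integral_dualityFunction_eq hp hρ hP hPgen hQ hQgen t η ξ
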